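/- **Conventions.** An *exactness sketch* is a finite graph with a set of commutativity conditions (pairs of parallel paths) and a set of finite limit and finite colimit conditions; such a condition is a 4-tuple $(\mathcal H,D,C,(c_H)_H)$ with $\mathcal H$ a finite graph, $D$ a graph morphism from $\mathcal H$ to the sketch, $C$ a vertex and arrows $c_H\colon C\to D(H)$ (respectively $c_H\colon D(H)\to C$), considered up to isomorphism of $\mathcal H$. Morphisms of sketches are graph morphisms preserving the conditions; a *subsketch inclusion* is one that is injective on vertices and arrows. For a sketch $\mathcal Z$ and a category $\mathbb C$, the category $\mathcal Z\mathbb C$ has as objects the *$\mathcal Z$-structures* in $\mathbb C$ (graph morphisms $\mathcal Z\to\mathbb C$ sending the commutativity conditions to commutative diagrams and the limit/colimit conditions to limits/colimits) and as morphisms the natural transformations. A sketch morphism $\varphi\colon\mathcal V\to\mathcal Z$ induces $\varphi_{\mathbb C}\colon\mathcal Z\mathbb C\to\mathcal V\mathbb C$ by composition, and $\mathcal Z^{\varphi}_G\mathbb C$ is the (strict) fibre of $\varphi_{\mathbb C}$ at $G$. A subsketch inclusion $\alpha\colon\mathcal X\to\mathcal A$ is *unconditional of finite kind* if the graph of $\mathcal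 A$ is the underlying graph of a finite category and the conditions of $\mathcal A$ are exactly the commutativity conditions expressing composition and identities of that category, together with the (images of the) conditions of $\mathcal X$. For subsketch inclusions $\mathcal X\xrightarrow{\alpha}\mathcal A\xrightarrow{\beta}\mathcal B$ and an $\mathcal X$-structure $F$ in $\mathbb C$, let $\beta^\alpha_F\colon\mathcal B^{\beta\alpha}_F\mathbb C\to\mathcal A^{\alpha}_F\mathbb C$ be the restriction of $\beta_{\mathbb C}$. A *functorial verification* of $\alpha\vdash\beta$ for $F$ is a functor $\beta'_F\colon\mathcal A^{\alpha}_F\mathbb C\to\mathcal B^{\beta\alpha}_F\mathbb C$ with $\beta^\alpha_F\circ\beta'_F=1$ (strictly). For a small finitely complete category $\mathbb C$, let $\mathsf y\colon\mathbb C\to\widetilde{\mathbb C}$ be its pro-completion, i.e. $\widetilde{\mathbb C}=\mathrm{Lex}(\mathbb C,\mathbf{Set})^{\mathrm{op}}$ with $\mathsf y(C)=\hom_{\mathbb C}(C,-)$; as usual, $\widetilde{\mathbb C}$ is realized (up to an equivalence of categories, under which $\mathsf y$ corresponds to the restricted Yoneda embedding up to natural isomorphism) in such a way that $\mathsf y$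 is injective on objects. As $\mathsf y$ preserves finite limits and finite colimits, composition with $\mathsf y$ gives functors $\mathsf y_{\mathcal Z}\colon\mathcal Z\mathbb C\to\mathcal Z\widetilde{\mathbb C}$, which restrict to functors $\mathsf y_{\mathcal A}^{\alpha,F}\colon\mathcal A^\alpha_F\mathbb C\to\mathcal A^\alpha_{\mathsf yF}\widetilde{\mathbb C}$ and $\mathsf y_{\mathcal B}^{\beta\alpha,F}\colon\mathcal B^{\beta\alpha}_F\mathbb C\to\mathcal B^{\beta\alpha}_{\mathsf yF}\widetilde{\mathbb C}$. **Theorem (coherence).** Let $\mathcal X\xrightarrow{\alpha}\mathcal A\xrightarrow{\beta}\mathcal B$ be subsketch inclusions with $\alpha$ unconditional of finite kind, let $\mathbb C$ be a small finitely complete category, let $F$ be an $\mathcal X$-structure in $\mathbb C$, and let $\beta'_F$ be a functorial verification of $\alpha\vdash\beta$ for $F$. Then there is a functorial verification $\beta'_{\mathsf yF}$ of $\alpha\vdash\beta$ for the $\mathcal X$-structure $\mathsf yF$ in $\widetilde{\mathbb C}$ such that $$\beta'_{\mathsf yF}\circ\mathsf y_{\mathcal A}^{\alpha,F}=\mathsf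 y_{\mathcal B}^{\beta\alpha,F}\circ\beta'_F$$ holds strictly, on objects and on morphisms, and such that, for every $G$ in $\mathcal A^\alpha_{\mathsf yF}\widetilde{\mathbb C}$, the structure $\beta'_{\mathsf yF}(G)$ is the limit in $\mathcal B\widetilde{\mathbb C}$ of the structures $\mathsf y_{\mathcal B}(\beta'_F(K))$ indexed by the comma category $(G\downarrow\mathsf y_{\mathcal A}^{\alpha,F})$ of pairs $(K,\,t\colon G\to\mathsf y_{\mathcal A}^{\alpha,F}(K))$, with limiting cone $(\beta'_{\mathsf yF}(t))_{(K,t)}$. -/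

import Mathlib

open CategoryTheory CategoryTheory.Limits

universe u v w w' v' u'

-- Use the usual underlying graph of a category for graph morphisms into it.
attribute [-instance] CategoryTheory.catToReflQuiver

/-! ### Graphs, diagrams, convergence conditions -/

/-- A finite graph (finitely many vertices and arrows). -/
structure FiniteGraph where
  V : Type
  [quiver : Quiver.{0} V]
  [finiteV : Finite V]
  [finiteHom : ∀ a b : V, Finite (a ⟶ b)]

attribute [instance] FiniteGraph.quiver FiniteGraph.finiteV FiniteGraph.finiteHom

/-- A 4-tuple `(H, D, C, (c_h : C ⟶ D h)_{h ∈ H})` in a graph `W`: a finite graph `H`, a morphism of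
graphs `D : H → W`, a vertex `C` of `W` and, for every vertex of `H`, an arrow of `W`. -/
structure ConeDatum (W : Type u) [Quiver.{v} W] where
  shape : FiniteGraph
  diagram : shape.V ⥤q W
  pt : W
  leg : ∀ h : shape.V, pt ⟶ diagram.obj h

/-- The dual notion: a 4-tuple `(H, D, C, (c_h : D h ⟶ C)_{h ∈ H})`. -/
structure CoconeDatum (W : Type u) [Quiver.{v} W] where
  shape : FiniteGraph
  diagram : shape.V ⥤q W
  pt : W
  leg : ∀ h : shape.V, diagram.obj h ⟶ pt

/-- Image of a 4-tuple under a morphism of graphs. -/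
def ConeDatum.map {W : Type u} [Quiver.{v} W] {W' : Type u'} [Quiver.{v'} W']
    (t : ConeDatum W) (φ : W ⥤q W') : ConeDatum W' where
  shape := t.shape
  diagram := t.diagram ⋙q φ
  pt := φ.obj t.pt
  leg h := φ.map (t.leg h)

/-- Image of a 4-tuple under a morphism of graphs. -/
def CoconeDatum.map {W : Type u} [Quiver.{v} W] {W' : Type u'} [Quiver.{v'} W']
    (t : CoconeDatum W) (φ : W ⥤q W') : CoconeDatum W' where
  shape := t.shape
  diagram := t.diagram ⋙q φ
  pt := φ.obj t.pt
  leg h := φ.map (t.leg h)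

/-- Precomposition of a 4-tuple with a morphism of graphs `I : H → H'`: the 4-tuple
`(H, D' I, C', (c'_{I h})_h)`. -/
def ConeDatum.reindex {W : Type u} [Quiver.{v} W] (t : ConeDatum W) (H : FiniteGraph)
    (I : H.V ⥤q t.shape.V) : ConeDatum W where
  shape := H
  diagram := I ⋙q t.diagram
  pt := t.pt
  leg h := t.leg (I.obj h)

/-- Precomposition of a 4-tuple with a morphism of graphs `I : H → H'`. -/
def CoconeDatum.reindex {W : Type u} [Quiver.{v} W] (t : CoconeDatum W) (H : FiniteGraph)
    (I : H.V ⥤q t.shape.V) : CoconeDatum W where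
  shape := H
  diagram := I ⋙q t.diagram
  pt := t.pt
  leg h := t.leg (I.obj h)

/-- Two 4-tuples `(H, D, C, c)`, `(H', D', C', c')` are equivalent if `C = C'` and there is an
isomorphism of graphs `I : H ≅ H'` with `D' I = D` and `c_h = c'_{I h}` for every `h`. -/
def ConeDatum.Equivalent {W : Type u} [Quiver.{v} W] (t t' : ConeDatum W) : Prop :=
  ∃ (I : t.shape.V ⥤q t'.shape.V) (J : t'.shape.V ⥤q t.shape.V),
    I ⋙q J = 𝟭q _ ∧ J ⋙q I = 𝟭q _ ∧ t = t'.reindex t.shape I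

/-- The same equivalence for the dual 4-tuples. -/
def CoconeDatum.Equivalent {W : Type u} [Quiver.{v} W] (t t' : CoconeDatum W) : Prop :=
  ∃ (I : t.shape.V ⥤q t'.shape.V) (J : t'.shape.V ⥤q t.shape.V),
    I ⋙q J = 𝟭q _ ∧ J ⋙q I = 𝟭q _ ∧ t = t'.reindex t.shape I

/-- In a category, the 4-tuple `(H, D, C, c)` is an actual limit: `c` is a cone over the diagram `D`
(indexed by a graph), and it is universal among such cones. -/
def ConeDatum.IsLimiting {C : Type u} [Category.{v} C] (t : ConeDatum C) : Prop :=
  (∀ {h k : t.shape.V} (e : h ⟶ k), t.leg h ≫ t.diagram.map e = t.leg k) ∧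
  ∀ (T : C) (x : ∀ h : t.shape.V, T ⟶ t.diagram.obj h),
    (∀ {h k : t.shape.V} (e : h ⟶ k), x h ≫ t.diagram.map e = x k) →
    ∃! f : T ⟶ t.pt, ∀ h, f ≫ t.leg h = x h

/-- In a category, the 4-tuple `(H, D, C, c)` is an actual colimit. -/
def CoconeDatum.IsColimiting {C : Type u} [Category.{v} C] (t : CoconeDatum C) : Prop :=
  (∀ {h k : t.shape.V} (e : h ⟶ k), t.diagram.map e ≫ t.leg k = t.leg h) ∧
  ∀ (T : C) (x : ∀ h : t.shape.V, t.diagram.obj h ⟶ T),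
    (∀ {h k : t.shape.V} (e : h ⟶ k), t.diagram.map e ≫ x k = x h) →
    ∃! f : t.pt ⟶ T, ∀ h, t.leg h ≫ f = x h

/-! ### Sketches -/

/-- An exactness sketch: a finite graph with a set of commutativity conditions (pairs of parallel
paths), a set of finite limit conditions and a set of finite colimit conditions. Since a convergence
condition is an equivalence class of 4-tuples, a set of convergence conditions is given as a set of
4-tuples that is closed under equivalence. -/
structure ExactnessSketch extends FiniteGraph where
  comm : ∀ {a b : V}, Quiver.Path a b → Quiver.Path a b → Prop
  lim : Set (ConeDatum V)
  lim_congr : ∀ {t t' : ConeDatum V}, t.Equivalent t' → (t ∈ lim ↔ t' ∈ lim)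
  colim : Set (CoconeDatum V)
  colim_congr : ∀ {t t' : CoconeDatum V}, t.Equivalent t' → (t ∈ colim ↔ t' ∈ colim)

namespace ExactnessSketch

/-- A morphism of sketches: a morphism of graphs that carries conditions to conditions. -/
structure Hom (X Y : ExactnessSketch) where
  graph : X.V ⥤q Y.V
  map_comm : ∀ {a b : X.V} (p q : Quiver.Path a b),
    X.comm p q → Y.comm (graph.mapPath p) (graph.mapPath q)
  map_lim : ∀ t ∈ X.lim, t.map graph ∈ Y.lim
  map_colim : ∀ t ∈ X.colim, t.map graph ∈ Y.colim

/-- Composite of morphisms of sketches, in diagrammatic order. -/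
def Hom.comp {X Y Z : ExactnessSketch} (φ : Hom X Y) (ψ : Hom Y Z) : Hom X Z where
  graph := φ.graph ⋙q ψ.graph
  map_comm p q h := by
    rw [Prefunctor.mapPath_comp_apply, Prefunctor.mapPath_comp_apply]
    exact ψ.map_comm _ _ (φ.map_comm p q h)
  map_lim t h := ψ.map_lim _ (φ.map_lim t h)
  map_colim t h := ψ.map_colim _ (φ.map_colim t h)

/-- Subsketch inclusions: the underlying morphism of graphs is injective (on vertices and on
arrows), i.e. it identifies its domain with a subgraph of its codomain. -/
def Hom.IsSubsketchInclusion {X Y : ExactnessSketch} (φ : Hom X Y) : Prop :=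
  Function.Injective φ.graph.obj ∧
    ∀ a b : X.V, Function.Injective (fun f : a ⟶ b => φ.graph.map f)

/-- The commutativity conditions of the underlying sketch of a category with identities `ident` and
composition `comp`: `((A,f,B,g,C),(A,gf,C))` for composable `f`, `g`, and `((A,1_A,A),(A))`. -/
inductive CategoryCondition {V : Type} [Quiver.{0} V] (ident : ∀ a : V, a ⟶ a)
    (comp : ∀ {a b c : V}, (a ⟶ b) → (b ⟶ c) → (a ⟶ c)) :
    ∀ {a b : V}, Quiver.Path a b → Quiver.Path a b → Prop
  | ofComp {a b c : V} (f : a ⟶ b) (g : b ⟶ c) :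
      CategoryCondition ident comp (f.toPath.comp g.toPath) (comp f g).toPath
  | ofId (a : V) : CategoryCondition ident comp (ident a).toPath Quiver.Path.nil

/-- The commutativity conditions of `A` which are images of those of `X`. -/
inductive ImageCondition {X A : ExactnessSketch} (α : Hom X A) :
    ∀ {a b : A.V}, Quiver.Path a b → Quiver.Path a b → Prop
  | of {x y : X.V} (p q : Quiver.Path x y) (h : X.comm p q) :
      ImageCondition α (α.graph.mapPath p) (α.graph.mapPath q)

/-- A subsketch inclusion `α : X → A` is unconditional of finite kind if the graph of `A` carries the
structure of a (necessarily finite) category such that `A` is the underlying sketch of this category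
equipped, further, with the commutativity and convergence conditions which already appear in `X`,
and with no others. -/
def Hom.UnconditionalOfFiniteKind {X A : ExactnessSketch} (α : Hom X A) : Prop :=
  α.IsSubsketchInclusion ∧
  ∃ (ident : ∀ a : A.V, a ⟶ a) (comp : ∀ {a b c : A.V}, (a ⟶ b) → (b ⟶ c) → (a ⟶ c)),
    (∀ {a b : A.V} (f : a ⟶ b), comp (ident a) f = f) ∧
    (∀ {a b : A.V} (f : a ⟶ b), comp f (ident b) = f) ∧
    (∀ {a b c d : A.V} (f : a ⟶ b) (g : b ⟶ c) (h : c ⟶ d),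
      comp (comp f g) h = comp f (comp g h)) ∧
    (∀ {a b : A.V} (p q : Quiver.Path a b),
      A.comm p q ↔ CategoryCondition ident comp p q ∨ ImageCondition α p q) ∧
    (∀ t : ConeDatum A.V, t ∈ A.lim ↔ ∃ s ∈ X.lim, t.Equivalent (s.map α.graph)) ∧
    (∀ t : CoconeDatum A.V, t ∈ A.colim ↔ ∃ s ∈ X.colim, t.Equivalent (s.map α.graph))

/-! ### Structures -/

/-- An `X`-structure in a category `C`: a morphism of graphs `X → C` which carries the commutativity
conditions of `X` to commutative diagrams and the convergence conditions of `X` to actual limits and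
colimits. -/
@[ext]
structure Str (X : ExactnessSketch) (C : Type u) [Category.{v} C] where
  graph : X.V ⥤q C
  comm : ∀ {a b : X.V} (p q : Quiver.Path a b), X.comm p q →
    composePath (graph.mapPath p) = composePath (graph.mapPath q)
  lim : ∀ t ∈ X.lim, (t.map graph).IsLimiting
  colim : ∀ t ∈ X.colim, (t.map graph).IsColimiting

/-- Natural transformations between `X`-structures. -/
@[ext]
structure Str.Hom {X : ExactnessSketch} {C : Type u} [Category.{v} C] (F G : X.Str C) where
  app : ∀ a : X.V, F.graph.obj a ⟶ G.graph.obj a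
  naturality : ∀ {a b : X.V} (f : a ⟶ b), F.graph.map f ≫ app b = app a ≫ G.graph.map f

/-- The category of `X`-structures in `C`. -/
instance (X : ExactnessSketch) (C : Type u) [Category.{v} C] : Category (X.Str C) where
  Hom F G := Str.Hom F G
  id F := ⟨fun _ => 𝟙 _, fun _ => by simp⟩
  comp m n := ⟨fun a => m.app a ≫ n.app a, fun f => by
    rw [← Category.assoc, m.naturality, Category.assoc, n.naturality, Category.assoc]⟩
  id_comp m := Str.Hom.ext (funext fun _ => Category.id_comp _)
  comp_id m := Str.Hom.ext (funext fun _ => Category.comp_id _)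
  assoc m n k := Str.Hom.ext (funext fun _ => Category.assoc _ _ _)

/-- The functor `φ_C : B C ⥤ A C` of composition with a morphism of sketches `φ : A → B`. -/
def restrict {A B : ExactnessSketch} (φ : Hom A B) (C : Type u) [Category.{v} C] :
    B.Str C ⥤ A.Str C where
  obj F :=
    { graph := φ.graph ⋙q F.graph
      comm := fun p q h => by
        rw [Prefunctor.mapPath_comp_apply, Prefunctor.mapPath_comp_apply]
        exact F.comm _ _ (φ.map_comm p q h)
      lim := fun t h => F.lim _ (φ.map_lim t h)
      colim := fun t h => F.colim _ (φ.map_colim t h) }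
  map m := ⟨fun a => m.app (φ.graph.obj a), fun f => m.naturality (φ.graph.map f)⟩
  map_id _ := rfl
  map_comp _ _ := rfl

end ExactnessSketch

/-! ### Functors that preserve finite limits and colimits act on structures -/

/-- The shape of multiequalizers in terms of which limits of diagrams indexed by a graph are
expressed. -/
abbrev FiniteGraph.conesShape (H : FiniteGraph) : MulticospanShape.{0, 0} where
  L := H.V
  R := Σ h : H.V, Σ k : H.V, (h ⟶ k)
  fst e := e.1
  snd e := e.2.1

/-- The shape of multicoequalizers in terms of which colimits of diagrams indexed by a graph are
expressed. -/
abbrev FiniteGraph.coconesShape (H : FiniteGraph) : MultispanShape.{0, 0} where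
  R := H.V
  L := Σ h : H.V, Σ k : H.V, (h ⟶ k)
  fst e := e.1
  snd e := e.2.1

theorem ConeDatum.IsLimiting.map {C : Type u} [Category.{v} C] {D : Type u'} [Category.{v'} D]
    (T : C ⥤ D) [PreservesFiniteLimits T] {t : ConeDatum C} (ht : t.IsLimiting) :
    (t.map T.toPrefunctor).IsLimiting := by
  classical
  obtain ⟨H, Δ, p, l⟩ := t
  obtain ⟨ht1, ht2⟩ := ht
  change ∀ {h k : H.V} (e : h ⟶ k), l h ≫ Δ.map e = l k at ht1
  change ∀ (T : C) (x : ∀ h : H.V, T ⟶ Δ.obj h),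
    (∀ {h k : H.V} (e : h ⟶ k), x h ≫ Δ.map e = x k) → ∃! f : T ⟶ p, ∀ h, f ≫ l h = x h at ht2
  have : Fintype H.conesShape.L := Fintype.ofFinite H.V
  have : Fintype H.conesShape.R := Fintype.ofFinite (Σ h : H.V, Σ k : H.V, (h ⟶ k))
  let I : MulticospanIndex H.conesShape C :=
    { left := fun h => Δ.obj h
      right := fun e => Δ.obj e.2.1
      fst := fun e => Δ.map e.2.2
      snd := fun e => 𝟙 (Δ.obj e.2.1) }
  let K : Multifork I := Multifork.ofι I p l (fun e =>
    (ht1 e.2.2).trans (Category.comp_id _).symm)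
  have hK : IsLimit K := by
    have key : ∀ E : Multifork I, ∃! f : E.pt ⟶ p, ∀ h, f ≫ l h = E.ι h := fun E =>
      ht2 E.pt E.ι (fun {h k} e => (E.condition ⟨h, k, e⟩).trans (Category.comp_id _))
    exact Multifork.IsLimit.mk K (fun E => (key E).choose) (fun E h => (key E).choose_spec.1 h)
      (fun E m hm => (key E).choose_spec.2 m hm)
  have hTK := isLimitOfPreserves T hK
  constructor
  · intro h k e
    exact (T.map_comp (l h) (Δ.map e)).symm.trans (congrArg T.map (ht1 e))
  · intro X x hx
    change ∀ h : H.V, X ⟶ T.obj (Δ.obj h) at x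
    change ∀ {h k : H.V} (e : h ⟶ k), x h ≫ T.map (Δ.map e) = x k at hx
    change ∃! f : X ⟶ T.obj p, ∀ h : H.V, f ≫ T.map (l h) = x h
    let c : Cone (I.multicospan ⋙ T) :=
      { pt := X
        π :=
          { app := fun j => match j with
              | .left h => x h
              | .right e => x e.2.1
            naturality := by
              rintro (h | e) (h' | e') (_ | _ | _)
              · exact (Category.id_comp _).trans (((congrArg (x h ≫ ·) (T.map_id _))).trans
                  (Category.comp_id _)).symm
              · exact (Category.id_comp _).trans (hx e'.2.2).symm
              · exact (Category.id_comp _).trans (((congrArg (x e'.2.1 ≫ ·) (T.map_id _))).trans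
                  (Category.comp_id _)).symm
              · exact (Category.id_comp _).trans (((congrArg (x e.2.1 ≫ ·) (T.map_id _))).trans
                  (Category.comp_id _)).symm } }
    refine ⟨hTK.lift c, fun h => hTK.fac c (.left h), fun g hg => ?_⟩
    refine hTK.uniq c g ?_
    rintro (h | e)
    · exact hg h
    · have h1 := (T.mapCone K).w (WalkingMulticospan.Hom.fst e)
      exact (congrArg (g ≫ ·) h1).symm.trans ((Category.assoc _ _ _).symm.trans
        ((congrArg (· ≫ T.map (Δ.map e.2.2)) (hg e.1)).trans (hx e.2.2)))

theorem CoconeDatum.IsColimiting.map {C : Type u} [Category.{v} C] {D : Type u'} [Category.{v'} D]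
    (T : C ⥤ D) [PreservesFiniteColimits T] {t : CoconeDatum C} (ht : t.IsColimiting) :
    (t.map T.toPrefunctor).IsColimiting := by
  classical
  obtain ⟨H, Δ, p, l⟩ := t
  obtain ⟨ht1, ht2⟩ := ht
  change ∀ {h k : H.V} (e : h ⟶ k), Δ.map e ≫ l k = l h at ht1
  change ∀ (T : C) (x : ∀ h : H.V, Δ.obj h ⟶ T),
    (∀ {h k : H.V} (e : h ⟶ k), Δ.map e ≫ x k = x h) → ∃! f : p ⟶ T, ∀ h, l h ≫ f = x h at ht2
  have : Fintype H.coconesShape.R := Fintype.ofFinite H.V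
  have : Fintype H.coconesShape.L := Fintype.ofFinite (Σ h : H.V, Σ k : H.V, (h ⟶ k))
  let I : MultispanIndex H.coconesShape C :=
    { right := fun h => Δ.obj h
      left := fun e => Δ.obj e.1
      fst := fun e => 𝟙 (Δ.obj e.1)
      snd := fun e => Δ.map e.2.2 }
  let K : Multicofork I := Multicofork.ofπ I p l (fun e =>
    (Category.id_comp _).trans (ht1 e.2.2).symm)
  have hK : IsColimit K := by
    have key : ∀ E : Multicofork I, ∃! f : p ⟶ E.pt, ∀ h, l h ≫ f = E.π h := fun E =>
      ht2 E.pt E.π (fun {h k} e => (E.condition ⟨h, k, e⟩).symm.trans (Category.id_comp _))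
    exact Multicofork.IsColimit.mk K (fun E => (key E).choose)
      (fun E h => (key E).choose_spec.1 h) (fun E m hm => (key E).choose_spec.2 m hm)
  have hTK := isColimitOfPreserves T hK
  constructor
  · intro h k e
    exact (T.map_comp (Δ.map e) (l k)).symm.trans (congrArg T.map (ht1 e))
  · intro X x hx
    change ∀ h : H.V, T.obj (Δ.obj h) ⟶ X at x
    change ∀ {h k : H.V} (e : h ⟶ k), T.map (Δ.map e) ≫ x k = x h at hx
    change ∃! f : T.obj p ⟶ X, ∀ h : H.V, T.map (l h) ≫ f = x h
    let c : Cocone (I.multispan ⋙ T) :=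
      { pt := X
        ι :=
          { app := fun j => match j with
              | .left e => x e.1
              | .right h => x h
            naturality := by
              rintro (e | h) (e' | h') (_ | _ | _)
              · exact ((congrArg (· ≫ x e.1) (T.map_id _)).trans (Category.id_comp _)).trans
                  (Category.comp_id _).symm
              · exact ((congrArg (· ≫ x e.1) (T.map_id _)).trans (Category.id_comp _)).trans
                  (Category.comp_id _).symm
              · exact (hx e.2.2).trans (Category.comp_id _).symm
              · exact ((congrArg (· ≫ x h) (T.map_id _)).trans (Category.id_comp _)).trans
                  (Category.comp_id _).symm } }
    refine ⟨hTK.desc c, fun h => hTK.fac c (.right h), fun g hg => ?_⟩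
    refine hTK.uniq c g ?_
    rintro (e | h)
    · have h1 := (T.mapCocone K).w (WalkingMultispan.Hom.snd e)
      exact (congrArg (· ≫ g) h1).symm.trans ((Category.assoc _ _ _).trans
        ((congrArg (T.map (Δ.map e.2.2) ≫ ·) (hg e.2.1)).trans (hx e.2.2)))
    · exact hg h

theorem Prefunctor.composePath_mapPath_functor {C : Type u} [Category.{v} C] {D : Type u'}
    [Category.{v'} D] (T : C ⥤ D) {a b : C} (p : Quiver.Path a b) :
    composePath (T.toPrefunctor.mapPath p) = T.map (composePath p) := by
  induction p with
  | nil => exact (T.map_id _).symm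
  | cons p e ih =>
    exact (congrArg (· ≫ T.map e) ih).trans (T.map_comp (composePath p) e).symm

namespace ExactnessSketch

/-- A functor `T : C ⥤ D` that preserves finite limits and finite colimits induces, for every sketch
`Z`, the functor `T_Z : Z C ⥤ Z D` of composition with `T`. -/
def postcomp (Z : ExactnessSketch) {C : Type u} [Category.{v} C] {D : Type u'} [Category.{v'} D]
    (T : C ⥤ D) [PreservesFiniteLimits T] [PreservesFiniteColimits T] : Z.Str C ⥤ Z.Str D where
  obj F :=
    { graph := F.graph ⋙q T.toPrefunctor
      comm := fun p q h => by
        rw [Prefunctor.mapPath_comp_apply, Prefunctor.mapPath_comp_apply]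
        exact (Prefunctor.composePath_mapPath_functor T _).trans
          ((congrArg T.map (F.comm p q h)).trans
            (Prefunctor.composePath_mapPath_functor T _).symm)
      lim := fun t h => (F.lim t h).map T
      colim := fun t h => (F.colim t h).map T }
  map m := ⟨fun a => T.map (m.app a), fun f => by
    change T.map _ ≫ T.map _ = T.map _ ≫ T.map _
    rw [← T.map_comp, ← T.map_comp, m.naturality]⟩
  map_id F := Str.Hom.ext (funext fun _ => T.map_id _)
  map_comp m n := Str.Hom.ext (funext fun _ => T.map_comp _ _)

end ExactnessSketch

/-! ### Fibres and verifications -/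

/-- In a commutative square of functors `T ⋙ q = p ⋙ S`, the functor `T` restricts to a functor from
the fibre of `p` at `b` to the fibre of `q` at `S b`. (The fibre of `p` at `b` has as objects the
objects strictly above `b` and as morphisms the morphisms strictly above the identity of `b`.) -/
def fiberFunctor {E : Type*} [Category* E] {E' : Type*} [Category* E'] {B : Type*} [Category* B]
    {B' : Type*} [Category* B'] {p : E ⥤ B} {q : E' ⥤ B'} (T : E ⥤ E') (S : B ⥤ B')
    (h : T ⋙ q = p ⋙ S) (b : B) : p.Fiber b ⥤ q.Fiber (S.obj b) where
  obj x := ⟨T.obj x.1, (Functor.congr_obj h x.1).trans (congrArg S.obj x.2)⟩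
  map {x y} m := ⟨T.map m.1, by
    refine IsHomLift.of_fac' q _ _ ((Functor.congr_obj h x.1).trans (congrArg S.obj x.2))
      ((Functor.congr_obj h y.1).trans (congrArg S.obj y.2)) ?_
    have := m.2
    have h1 : q.map (T.map m.1) = _ := Functor.congr_hom h m.1
    rw [h1, Functor.comp_map, IsHomLift.fac' p (𝟙 b) m.1]
    simp [eqToHom_map]⟩
  map_id x := Subtype.ext (T.map_id _)
  map_comp m n := Subtype.ext (T.map_comp _ _)

namespace ExactnessSketch

variable {X A B : ExactnessSketch}

/-- `A^α_F C`, the fibre at the `X`-structure `F` of the functor `α_C : A C ⥤ X C`. -/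
abbrev Extensions (α : Hom X A) {C : Type u} [Category.{v} C] (F : X.Str C) :=
  (restrict α C).Fiber F

/-- The functor `β^α_F : B^{βα}_F C ⥤ A^α_F C`, the restriction of `β_C`. -/
def restrictExtensions (α : Hom X A) (β : Hom A B) {C : Type u} [Category.{v} C] (F : X.Str C) :
    Extensions (α.comp β) F ⥤ Extensions α F :=
  fiberFunctor (restrict β C) (𝟭 (X.Str C)) rfl F

/-- The functor `T_A^{α,F} : A^α_F C ⥤ A^α_{TF} D`, the restriction of `T_A : A C ⥤ A D`. -/
def postcompExtensions (α : Hom X A) {C : Type u} [Category.{v} C] {D : Type u'} [Category.{v'} D]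
    (T : C ⥤ D) [PreservesFiniteLimits T] [PreservesFiniteColimits T] (F : X.Str C) :
    Extensions α F ⥤ Extensions α ((X.postcomp T).obj F) :=
  fiberFunctor (A.postcomp T) (X.postcomp T) rfl F

/-- A functorial verification of `α ⊢ β` for `F`: a functor `A^α_F C ⥤ B^{βα}_F C` which is (strictly)
a right inverse of `β^α_F`. -/
structure FunctorialVerification (α : Hom X A) (β : Hom A B) {C : Type u} [Category.{v} C]
    (F : X.Str C) where
  functor : Extensions α F ⥤ Extensions (α.comp β) F
  comp_restrict : functor ⋙ restrictExtensions α β F = 𝟭 (Extensions α F)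

end ExactnessSketch

/-! ### The pro-completion -/

/-- The pro-completion of a small finitely complete category `C`: the dual of the category
`Lex(C, Set)` of finite limit preserving functors. -/
abbrev ProLex (C : Type u) [SmallCategory C] := (C ⥤ₗ Type u)ᵒᵖ

/-- The restricted Yoneda embedding `C ⥤ Lex(C, Set)ᵒᵖ`, `c ↦ Hom(c, -)`. -/
def proYoneda (C : Type u) [SmallCategory C] : C ⥤ ProLex C :=
  Functor.rightOp ((leftExactFunctor C (Type u)).lift coyoneda
    (fun _ => by rw [leftExactFunctor_iff]; infer_instance))

/-- `y : C ⥤ P` is (a realization of) the pro-completion of `C`: up to an equivalence of categories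
`P ≌ Lex(C, Set)ᵒᵖ`, it is the restricted Yoneda embedding. In particular this holds for
`P = Lex(C, Set)ᵒᵖ` and the restricted Yoneda embedding itself. -/
def IsProCompletion {C : Type u} [SmallCategory C] {P : Type w} [Category.{w'} P] (y : C ⥤ P) :
    Prop :=
  ∃ e : P ≌ ProLex C, Nonempty (y ⋙ e.functor ≅ proYoneda C)

theorem isProCompletion_proYoneda (C : Type u) [SmallCategory C] :
    IsProCompletion (proYoneda C) :=
  ⟨CategoryTheory.Equivalence.refl, ⟨(proYoneda C).rightUnitor⟩⟩

instance (C : Type u) [SmallCategory C] : PreservesFiniteColimits (proYoneda C) := by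
  have h : PreservesLimitsOfSize.{0, 0} ((leftExactFunctor C (Type u)).lift coyoneda
      (fun _ => by rw [leftExactFunctor_iff]; infer_instance)) := by
    have : PreservesLimitsOfSize.{0, 0} ((leftExactFunctor C (Type u)).lift coyoneda
      (fun _ => by rw [leftExactFunctor_iff]; infer_instance) ⋙
        (leftExactFunctor C (Type u)).ι) :=
      inferInstanceAs (PreservesLimitsOfSize.{0, 0} (coyoneda (C := C)))
    exact preservesLimits_of_reflects_of_preserves _ (leftExactFunctor C (Type u)).ι
  have : PreservesColimitsOfSize.{0, 0} (proYoneda C) := preservesColimitsOfSize_rightOp _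
  infer_instance

/-- Maps `Hom(c, -) ⟶ L` correspond to elements of `L c`, naturally in `c`. -/
def proYonedaCompIso (C : Type u) [SmallCategory C] (L : C ⥤ₗ Type u) :
    proYoneda C ⋙ coyoneda.obj (Opposite.op (Opposite.op L)) ≅ L.obj :=
  NatIso.ofComponents (fun c => Equiv.toIso
    (((opEquiv _ _).trans (leftExactFunctor C (Type u)).fullyFaithfulι.homEquiv).trans
      coyonedaEquiv)) (fun {c d} f => by
        ext x
        exact (coyonedaEquiv_naturality x.unop.hom f).symm)

instance (C : Type u) [SmallCategory C] : PreservesFiniteLimits (proYoneda C) where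
  preservesFiniteLimits J _ _ :=
    ⟨fun {K} => ⟨fun {c} hc => ⟨coyonedaJointlyReflectsLimits _ _ fun X => by
      have : PreservesFiniteLimits X.unop.unop.obj := X.unop.unop.property
      have : PreservesFiniteLimits
        (proYoneda C ⋙ coyoneda.obj (Opposite.op (Opposite.op X.unop.unop))) :=
        preservesFiniteLimits_of_natIso (proYonedaCompIso C X.unop.unop).symm
      exact isLimitOfPreserves (proYoneda C ⋙ coyoneda.obj X) hc⟩⟩⟩

namespace IsProCompletion

variable {C : Type u} [SmallCategory C] {P : Type w} [Category.{w'} P] {y : C ⥤ P}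

theorem preservesFiniteLimits (hy : IsProCompletion y) : PreservesFiniteLimits y := by
  obtain ⟨e, ⟨i⟩⟩ := hy
  have : PreservesFiniteLimits (y ⋙ e.functor) := preservesFiniteLimits_of_natIso i.symm
  exact preservesFiniteLimits_of_reflects_of_preserves y e.functor

theorem preservesFiniteColimits (hy : IsProCompletion y) : PreservesFiniteColimits y := by
  obtain ⟨e, ⟨i⟩⟩ := hy
  have : PreservesFiniteColimits (y ⋙ e.functor) := preservesFiniteColimits_of_natIso i.symm
  exact preservesFiniteColimits_of_reflects_of_preserves y e.functor

/-- The functor `y_Z : Z C ⥤ Z P`, `S ↦ y S`. -/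
def onStr (hy : IsProCompletion y) (Z : ExactnessSketch) : Z.Str C ⥤ Z.Str P :=
  haveI := hy.preservesFiniteLimits
  haveI := hy.preservesFiniteColimits
  Z.postcomp y

/-- The functor `y_Z^{α,F} : Z^α_F C ⥤ Z^α_{yF} P`, the restriction of `y_Z`. -/
def onExtensions (hy : IsProCompletion y) {X Z : ExactnessSketch} (α : X.Hom Z) (F : X.Str C) :
    ExactnessSketch.Extensions α F ⥤ ExactnessSketch.Extensions α ((hy.onStr X).obj F) :=
  haveI := hy.preservesFiniteLimits
  haveI := hy.preservesFiniteColimits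
  ExactnessSketch.postcompExtensions α y F

end IsProCompletion

/-! The extension is the pointwise right Kan extension of `y β'` along the functor that `y` induces
on extensions of `F`: its value at `G` is the limit of the structures `y (β' K)` over the comma
category of `G`. Three facts make this limit exist and behave strictly.

Uniformity (`IsProCompletion.uniformity`): the comma category of `G` is cofiltered, and each arrow
from `G a` to some `y c` factors through a component of some `G ⟶ y K`, essentially uniquely. Since
`A` is a finite category whose remaining conditions come from `X`, it suffices to construct
functors. Finite products in `C` provide coinduced functors, and `exists_factor_iso` cuts out by an
equalizer a functor that agrees with `F` on `X`.

Exactness: `y` is codense, so arrows into an object are natural families indexed by its arrows into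
the objects `y a`. A cofiltered cone through whose legs such arrows factor essentially uniquely is
therefore a limit (`IsAccessibleCone.nonempty_isLimit`), and limits of this kind commute with finite
colimits (`IsVertexwiseLimit.isColimiting`) as well as with finite limits. Hence a vertexwise limit
of `B`-structures of this kind is again a `B`-structure.

Strictness: at a vertex `a` of `A` the diagram is `K ↦ y (K a)`, because `β'` is a strict section,
and uniformity makes `G a` itself a limit of it. At other vertices any limit will do, so the limit
structure can be taken strictly above `G`. When `G` is `y K`, the comma category has an initial
object and the value `y (β' K)` can be taken; injectivity of `y` on objects makes this unambiguous.
Universal properties then give the action on morphisms (`exists_strict_section`). -/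

/-! ### Strict sections from chosen pointwise limits. -/

section StrictSection

universe v₁ v₂ v₃ v₄ v₅ u₁ u₂ u₃ u₄ u₅

variable {E : Type u₁} [Category.{v₁} E] {E' : Type u₂} [Category.{v₂} E']
  {D : Type u₃} [Category.{v₃} D] {D' : Type u₄} [Category.{v₄} D'] {Q : Type u₅} [Category.{v₅} Q]

/-- A cone over the objects `V K`, indexed by all arrows `G ⟶ S K`. -/
structure CommaCone (S : E ⥤ D) (V : E ⥤ D') (G : D) where
  pt : D'
  π : ∀ {K : E}, (G ⟶ S.obj K) → (pt ⟶ V.obj K)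
  w : ∀ {K L : E} (t : G ⟶ S.obj K) (f : K ⟶ L), π t ≫ V.map f = π (t ≫ S.map f)

/-- The underlying cone of a `CommaCone`. -/
def CommaCone.cone {S : E ⥤ D} {V : E ⥤ D'} {G : D} (c : CommaCone S V G) :
    Cone (StructuredArrow.proj G S ⋙ V) where
  pt := c.pt
  π :=
    { app j := c.π j.hom
      naturality j k f := by
        have h1 := c.w j.hom f.right
        rw [StructuredArrow.w] at h1
        change 𝟙 _ ≫ c.π k.hom = c.π j.hom ≫ V.map f.right
        rw [Category.id_comp, h1] }

/-- A limit cone with apex strictly above `G` whose legs are strictly above the arrows `G ⟶ S K`, and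
which remains a limit cone after applying `I`. -/
structure StrictLimitCone (S : E ⥤ D) (V : E ⥤ D') (r : D' ⥤ D) (I : D' ⥤ Q)
    (h : ∀ K, S.obj K = r.obj (V.obj K)) (G : D) extends CommaCone S V G where
  isLimit : IsLimit toCommaCone.cone
  isLimitMap : IsLimit (I.mapCone toCommaCone.cone)
  obj_eq : r.obj pt = G
  map_eq : ∀ {K : E} (t : G ⟶ S.obj K), r.map (π t) = eqToHom obj_eq ≫ t ≫ eqToHom (h K)

theorem isLimit_of_isIso_initial {J : Type*} [Category* J] {i : J} (hi : IsInitial i)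
    {F : J ⥤ Q} (c : Cone F) (hc : IsIso (c.π.app i)) : Nonempty (IsLimit c) :=
  ⟨IsLimit.ofIsoLimit (limitOfDiagramInitial hi F) (Iso.symm (Cone.ext (asIso (c.π.app i))
    (fun j => by
      change c.π.app j = c.π.app i ≫ F.map (hi.to j)
      rw [c.w])))⟩

variable {S : E ⥤ D} {V : E ⥤ D'} {r : D' ⥤ D} {I : D' ⥤ Q}

/-- As `S` is fully faithful, the identity of `S K` is initial in the comma category, so `V K` is
the limit and any `I` preserves it. The clause about `K'` lets the cone be used for an object known
only to be equal to some `S K'`; injectivity of `S` on objects makes all such `K'` coincide. -/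
theorem exists_strictLimitCone_of_obj_eq [S.Full] [S.Faithful] (hinj : Function.Injective S.obj)
    (hV : V ⋙ r = S) (h : ∀ K, S.obj K = r.obj (V.obj K)) (K : E) :
    ∃ c : StrictLimitCone S V r I h (S.obj K), ∀ (K' : E) (e : S.obj K' = S.obj K),
      ∃ hp : c.pt = V.obj K', ∀ (L : E) (t : K' ⟶ L),
        c.π (eqToHom e.symm ≫ S.map t) = eqToHom hp ≫ V.map t := by
  have hi : IsInitial (StructuredArrow.mk (𝟙 (S.obj K))) := StructuredArrow.mkIdInitial
  let c : CommaCone S V (S.obj K) :=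
    { pt := V.obj K
      π t := V.map (S.preimage t)
      w t f := by
        rw [← V.map_comp]
        congr 1
        exact S.map_injective (by simp) }
  have hc1 : c.π (𝟙 (S.obj K)) = 𝟙 (V.obj K) := by simp [c]
  have hc : IsIso (c.π (𝟙 (S.obj K))) := by rw [hc1]; infer_instance
  have hIc : IsIso (I.map (c.π (𝟙 (S.obj K)))) := by rw [hc1, I.map_id]; infer_instance
  refine ⟨⟨c, (isLimit_of_isIso_initial hi _ hc).some, (isLimit_of_isIso_initial hi _ hIc).some,
    (h K).symm, fun t => ?_⟩, fun K' e => ?_⟩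
  · have h1 := Functor.congr_hom hV (S.preimage t)
    change r.map (V.map (S.preimage t)) = _
    rw [Functor.comp_map] at h1
    rw [h1, Functor.map_preimage]
  · obtain rfl := hinj e
    refine ⟨rfl, fun L t => ?_⟩
    simp [c]

/-- One limit cone is chosen for each `G`, and arrows are induced by the universal property. The
equality `S ⋙ T = V` depends on the choice made over the image of `S`. For `T ⋙ r = 𝟭 D` on arrows,
`hmono` reduces the question to composites with arrows into objects `S K`, where the legs are known
to lie strictly above those arrows. -/
theorem exists_strict_section [S.Full] [S.Faithful] (hinj : Function.Injective S.obj)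
    (hV : V ⋙ r = S) (h : ∀ K, S.obj K = r.obj (V.obj K))
    (hmono : ∀ {G G' : D} (m m' : G' ⟶ G),
      (∀ (K : E) (t : G ⟶ S.obj K), m ≫ t = m' ≫ t) → m = m')
    (H : ∀ G : D, Nonempty (StrictLimitCone S V r I h G)) :
    ∃ T : D ⥤ D', T ⋙ r = 𝟭 D ∧ S ⋙ T = V ∧
      Nonempty (Functor.RightExtension.mk (T ⋙ I)
        (𝟙 (S ⋙ T ⋙ I))).IsPointwiseRightKanExtension := by
  have H' : ∀ G : D, ∃ c : StrictLimitCone S V r I h G, ∀ (K : E) (e : S.obj K = G),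
      ∃ hp : c.pt = V.obj K, ∀ (L : E) (t : K ⟶ L),
        c.π (eqToHom e.symm ≫ S.map t) = eqToHom hp ≫ V.map t := by
    intro G
    -- Over the image of `S` the cone with apex `V K` is taken; only elsewhere is the choice
    -- arbitrary.
    by_cases hG : ∃ K, S.obj K = G
    · obtain ⟨K, rfl⟩ := hG
      exact exists_strictLimitCone_of_obj_eq hinj hV h K
    · exact ⟨(H G).some, fun K e => (hG ⟨K, e⟩).elim⟩
  choose c hc using H'
  choose hp hπ using hc
  have hext : ∀ {G : D} {Z : D'} (a b : Z ⟶ (c G).pt),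
      (∀ (K : E) (t : G ⟶ S.obj K), a ≫ (c G).π t = b ≫ (c G).π t) → a = b :=
    fun {G Z} a b hab => (c G).isLimit.hom_ext fun j => hab j.right j.hom
  have hlift : ∀ {G G' : D} (m : G ⟶ G'), ∃ l : (c G).pt ⟶ (c G').pt,
      ∀ (K : E) (t : G' ⟶ S.obj K), l ≫ (c G').π t = (c G).π (m ≫ t) := fun {G G'} m => by
    let x : CommaCone S V G' := ⟨(c G).pt, fun t => (c G).π (m ≫ t), fun t f => by
      rw [(c G).w, Category.assoc]⟩
    exact ⟨(c G').isLimit.lift x.cone, fun K t => (c G').isLimit.fac x.cone (.mk t)⟩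
  choose lift fac using @hlift
  let T : D ⥤ D' :=
    { obj G := (c G).pt
      map m := lift m
      map_id G := hext _ _ fun K t => by rw [fac, Category.id_comp, Category.id_comp]
      map_comp m n := hext _ _ fun K t => by
        rw [fac, Category.assoc (lift m), fac, fac, Category.assoc] }
  have hid : ∀ K, (c (S.obj K)).π (𝟙 (S.obj K)) = eqToHom (hp _ K rfl) := fun K => by
    have := hπ _ K rfl K (𝟙 K)
    rwa [eqToHom_refl, Category.id_comp, S.map_id, V.map_id, Category.comp_id] at this
  have hST : S ⋙ T = V := by
    refine CategoryTheory.Functor.ext (fun K => hp _ K rfl) (fun K K' f => ?_)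
    have h1 := fac (S.map f) K' (𝟙 _)
    have h2 := hπ _ K rfl K' f
    rw [eqToHom_refl, Category.id_comp] at h2
    rw [hid, Category.comp_id, h2] at h1
    change lift (S.map f) = _ ≫ V.map f ≫ _
    rw [← Category.assoc, ← h1]
    simp
  refine ⟨T, ?_, hST, ?_⟩
  · refine CategoryTheory.Functor.ext (fun G => (c G).obj_eq) (fun G G' m => ?_)
    change r.map (lift m) = _ ≫ m ≫ _
    rw [← cancel_mono (eqToHom (c G').obj_eq)]
    refine hmono _ _ fun K t => ?_
    have h1 := congrArg r.map (fac m K t)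
    rw [r.map_comp, (c G').map_eq, (c G).map_eq, ← cancel_mono (eqToHom (h K).symm)] at h1
    simpa using h1
  · refine ⟨fun G => ?_⟩
    -- The Kan extension cone lives over `S ⋙ T`, the chosen limit cone over `V`; the equality `hST`
    -- identifies the two diagrams.
    let e' : StructuredArrow.proj G S ⋙ S ⋙ T ⋙ I ≅ StructuredArrow.proj G S ⋙ V ⋙ I :=
      Functor.isoWhiskerLeft (StructuredArrow.proj G S) (Functor.isoWhiskerRight (eqToIso hST) I)
    refine (IsLimit.postcomposeHomEquiv e' _) (IsLimit.ofIsoLimit (c G).isLimitMap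
      (Cone.ext (Iso.refl _) fun j => ?_))
    have h1 := fac j.hom j.right (𝟙 _)
    rw [hid, Category.comp_id] at h1
    have h2 : (eqToHom hST).app j.right = eqToHom (hp _ j.right rfl) := eqToHom_app _ _
    change I.map ((c G).π j.hom) =
      𝟙 _ ≫ (I.map (lift j.hom) ≫ 𝟙 _) ≫ I.map ((eqToHom hST).app j.right)
    rw [Category.id_comp, Category.comp_id, h2, ← h1]
    exact I.map_comp _ _

end StrictSection

/-! ### Codense functors and accessible cones. -/

section Accessible

variable {C : Type u} [Category.{v} C] {P : Type w} [Category.{w'} P]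

/-- A cone is accessible relative to `y : C ⥤ P` if every arrow from its apex to an object `y a`
factors through some leg, essentially uniquely. -/
structure IsAccessibleCone (y : C ⥤ P) {J : Type*} [Category* J] {D : J ⥤ P} (c : Cone D) :
    Prop where
  exists_fac : ∀ {a : C} (g : c.pt ⟶ y.obj a), ∃ (j : J) (h : D.obj j ⟶ y.obj a),
    c.π.app j ≫ h = g
  exists_eq : ∀ {a : C} {j : J} (h h' : D.obj j ⟶ y.obj a), c.π.app j ≫ h = c.π.app j ≫ h' →
    ∃ (k : J) (f : k ⟶ j), D.map f ≫ h = D.map f ≫ h'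

/-- A family of maps between hom-sets into the objects `y a`, natural in `a`, is induced by a unique
arrow. -/
def IsCodense (y : C ⥤ P) : Prop :=
  ∀ (Z W : P) (φ : ∀ a : C, (Z ⟶ y.obj a) → (W ⟶ y.obj a)),
    (∀ {a b : C} (f : a ⟶ b) (g : Z ⟶ y.obj a), φ b (g ≫ y.map f) = φ a g ≫ y.map f) →
    ∃! m : W ⟶ Z, ∀ (a : C) (g : Z ⟶ y.obj a), m ≫ g = φ a g

variable {y : C ⥤ P}

theorem IsCodense.hom_ext (hy : IsCodense y) {W Z : P} {m m' : W ⟶ Z}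
    (h : ∀ (a : C) (g : Z ⟶ y.obj a), m ≫ g = m' ≫ g) : m = m' :=
  (hy Z W (fun _ g => m' ≫ g) (fun _ _ => (Category.assoc _ _ _).symm)).unique h fun _ _ => rfl

variable {J : Type*} [Category* J] [IsCofiltered J] {D : J ⥤ P} {c : Cone D}

theorem IsAccessibleCone.comp_eq_comp (hc : IsAccessibleCone y c) {a : C} {i j : J}
    (f : D.obj i ⟶ y.obj a) (g : D.obj j ⟶ y.obj a) (h : c.π.app i ≫ f = c.π.app j ≫ g) :
    ∃ (k : J) (p : k ⟶ i) (q : k ⟶ j), D.map p ≫ f = D.map q ≫ g := by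
  obtain ⟨k, hk, h'⟩ := hc.exists_eq (D.map (IsCofiltered.minToLeft i j) ≫ f)
    (D.map (IsCofiltered.minToRight i j) ≫ g) (by rw [c.w_assoc, c.w_assoc, h])
  exact ⟨k, hk ≫ IsCofiltered.minToLeft i j, hk ≫ IsCofiltered.minToRight i j, by simpa using h'⟩

/-- For another cone `s`, an arrow `g` from the apex of `c` to `y a` factors as a leg followed by
`h`, and is sent to the corresponding leg of `s` followed by `h`. Essential uniqueness makes this
independent of the factorization and natural in `a`, so codensity turns it into the required arrow.
-/
theorem IsAccessibleCone.nonempty_isLimit (hy : IsCodense y) (hc : IsAccessibleCone y c) :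
    Nonempty (IsLimit c) := by
  choose j h hj using @hc.exists_fac
  have huniq : ∀ (s : Cone D) {a : C} {i k : J} (f : D.obj i ⟶ y.obj a) (g : D.obj k ⟶ y.obj a),
      c.π.app i ≫ f = c.π.app k ≫ g → s.π.app i ≫ f = s.π.app k ≫ g := by
    intro s a i k f g hfg
    obtain ⟨l, p, q, hl⟩ := hc.comp_eq_comp f g hfg
    rw [← s.w p, ← s.w q, Category.assoc, hl, Category.assoc]
  have key : ∀ s : Cone D, ∃! m : s.pt ⟶ c.pt, ∀ (a : C) (g : c.pt ⟶ y.obj a),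
      m ≫ g = s.π.app (j g) ≫ h g := fun s =>
    hy c.pt s.pt (fun a g => s.π.app (j g) ≫ h g) fun {a b} f g => by
      rw [Category.assoc]
      apply huniq
      rw [hj, ← Category.assoc, hj]
  refine ⟨⟨fun s => (key s).choose, fun s i => hy.hom_ext fun a g => ?_, fun s m hm => ?_⟩⟩
  · rw [Category.assoc, (key s).choose_spec.1]
    exact huniq _ _ _ (hj _)
  · refine (key s).choose_spec.2 _ fun a g => ?_
    rw [← hm, Category.assoc, hj]

end Accessible

/-! ### Codensity and cofiltered limits in the pro-completion. -/

section ProCompletion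

variable {C : Type u} [SmallCategory C] {P : Type w} [Category.{w'} P] {y : C ⥤ P}

instance : (proYoneda C).Full :=
  inferInstanceAs (Functor.rightOp _).Full

instance : (proYoneda C).Faithful :=
  inferInstanceAs (Functor.rightOp _).Faithful

namespace IsProCompletion

theorem full (hy : IsProCompletion y) : y.Full := by
  obtain ⟨e, ⟨i⟩⟩ := hy
  have : (y ⋙ e.functor).Full := Functor.Full.of_iso i.symm
  exact Functor.Full.of_comp_faithful y e.functor

theorem faithful (hy : IsProCompletion y) : y.Faithful := by
  obtain ⟨e, ⟨i⟩⟩ := hy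
  have : (y ⋙ e.functor).Faithful := Functor.Faithful.of_iso i.symm
  exact Functor.Faithful.of_comp y e.functor

/-- The contravariant representation of a pro-completion by finite limit preserving functors, together
with the bijection between arrows `Z ⟶ y a` and elements of the functor represented by `Z` at `a`. -/
theorem exists_elements (hy : IsProCompletion y) :
    ∃ (M : P ⥤ (C ⥤ Type u)ᵒᵖ) (θ : ∀ {Z : P} {a : C}, (Z ⟶ y.obj a) ≃ (M.obj Z).unop.obj a),
      M.Full ∧ M.Faithful ∧
      (∀ L : C ⥤ Type u, PreservesFiniteLimits L → ∃ Z, Nonempty ((M.obj Z).unop ≅ L)) ∧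
      (∀ {Z : P} {a b : C} (g : Z ⟶ y.obj a) (f : a ⟶ b),
        θ (g ≫ y.map f) = (M.obj Z).unop.map f (θ g)) ∧
      ∀ {W Z : P} {a : C} (m : W ⟶ Z) (g : Z ⟶ y.obj a),
        θ (m ≫ g) = (M.map m).unop.app a (θ g) := by
  obtain ⟨e, ⟨i⟩⟩ := hy
  let ι := (leftExactFunctor C (Type u)).ι
  let η : ∀ (L : ProLex C) (a : C), (L ⟶ (proYoneda C).obj a) ≃ L.unop.obj.obj a := fun L a =>
    ((opEquiv _ _).trans (leftExactFunctor C (Type u)).fullyFaithfulι.homEquiv).trans coyonedaEquiv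
  have hη1 : ∀ (L : ProLex C) {a b : C} (g : L ⟶ (proYoneda C).obj a) (f : a ⟶ b),
      η L b (g ≫ (proYoneda C).map f) = L.unop.obj.map f (η L a g) := fun L a b g f =>
    (coyonedaEquiv_naturality g.unop.hom f).symm
  have hη2 : ∀ (L L' : ProLex C) {a : C} (m : L' ⟶ L) (g : L ⟶ (proYoneda C).obj a),
      η L' a (m ≫ g) = m.unop.hom.app a (η L a g) := fun L L' a m g =>
    coyonedaEquiv_comp g.unop.hom m.unop.hom
  refine ⟨e.functor ⋙ ι.op, fun {Z a} => ((e.fullyFaithfulFunctor.homEquiv).trans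
    ((i.app a).homToEquiv)).trans (η _ a), inferInstance, inferInstance, fun L hL => ?_,
    fun {Z a b} g f => ?_, fun {W Z a} m g => ?_⟩
  · let L' : C ⥤ₗ Type u := ⟨L, hL⟩
    exact ⟨e.inverse.obj (Opposite.op L'),
      ⟨(ι.op.mapIso (e.counitIso.app (Opposite.op L'))).unop.symm⟩⟩
  · have := i.hom.naturality f
    change η _ b (e.functor.map (g ≫ y.map f) ≫ i.hom.app b) =
      (e.functor.obj Z).unop.obj.map f (η _ a (e.functor.map g ≫ i.hom.app a))
    rw [← hη1, Category.assoc, ← this, e.functor.map_comp, Category.assoc]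
    rfl
  · change η _ a (e.functor.map (m ≫ g) ≫ i.hom.app a) =
      (e.functor.map m).unop.hom.app a (η _ a (e.functor.map g ≫ i.hom.app a))
    rw [← hη2, e.functor.map_comp, Category.assoc]

theorem locallySmall (hy : IsProCompletion y) : LocallySmall.{u} P := by
  obtain ⟨M, _, _, _, _⟩ := hy.exists_elements
  exact locallySmall_of_faithful M

/-- Through `θ`, a natural family is a transformation from the functor representing `Z` to the one
representing `W`; since `M` is fully faithful, this is the same as an arrow `W ⟶ Z`. -/
theorem isCodense (hy : IsProCompletion y) : IsCodense y := by
  obtain ⟨M, θ, _, _, -, h1, h2⟩ := hy.exists_elements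
  intro Z W φ hφ
  let n : (M.obj Z).unop ⟶ (M.obj W).unop :=
    { app a := TypeCat.ofHom fun x => θ (φ a (θ.symm x))
      naturality a b f := by
        ext x
        obtain ⟨g, rfl⟩ := θ.surjective x
        change θ (φ b (θ.symm ((M.obj Z).unop.map f (θ g)))) =
          (M.obj W).unop.map f (θ (φ a (θ.symm (θ g))))
        rw [← h1, ← h1, Equiv.symm_apply_apply, Equiv.symm_apply_apply, hφ] }
  refine ⟨M.preimage n.op, fun a g => θ.injective ?_, fun m hm => M.map_injective ?_⟩
  · rw [h2, Functor.map_preimage]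
    change θ (φ a (θ.symm (θ g))) = _
    rw [Equiv.symm_apply_apply]
  · rw [Functor.map_preimage]
    apply Quiver.Hom.unop_inj
    ext a x
    obtain ⟨g, rfl⟩ := θ.surjective x
    change (M.map m).unop.app a (θ g) = θ (φ a (θ.symm (θ g)))
    rw [← h2, hm, Equiv.symm_apply_apply]

/-- The filtered colimit of the representables `Hom(d j, -)` preserves finite limits, so it is
represented by some `Z`. The two clauses of accessibility are the usual description of a filtered
colimit of sets: each element comes from a stage, and elements of one stage are identified exactly
when they agree at a later one. -/
theorem exists_isAccessibleCone_of_small (hy : IsProCompletion y) {J : Type u} [SmallCategory J]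
    [IsCofiltered J] (d : J ⥤ C) : ∃ c : Cone (d ⋙ y), IsAccessibleCone y c := by
  obtain ⟨M, θ, _, _, h3, h1, h2⟩ := hy.exists_elements
  let F : C ⥤ Jᵒᵖ ⥤ Type u := (d.op ⋙ coyoneda).flip
  have hF : PreservesFiniteLimits F := ⟨fun K _ _ => by
    apply preservesLimitsOfShape_of_evaluation
    intro j
    exact inferInstanceAs (PreservesLimitsOfShape K (coyoneda.obj (Opposite.op (d.obj j.unop))))⟩
  have hL : PreservesFiniteLimits (F ⋙ colim) := comp_preservesFiniteLimits _ _
  obtain ⟨Z, ⟨i⟩⟩ := h3 _ hL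
  -- The element of the functor represented by `Z` that is named by an arrow out of stage `j`.
  let x : ∀ (j : J) {a : C}, (d.obj j ⟶ a) → (M.obj Z).unop.obj a := fun j a f =>
    i.inv.app a (colimit.ι (F.obj a) (Opposite.op j) f)
  have hx : ∀ (j : J) {a b : C} (f : d.obj j ⟶ a) (g : a ⟶ b),
      (M.obj Z).unop.map g (x j f) = x j (f ≫ g) := by
    intro j a b f g
    have e1 := ConcreteCategory.congr_hom (i.inv.naturality g)
      (colimit.ι (F.obj a) (Opposite.op j) f)
    have e2 := ConcreteCategory.congr_hom (ι_colimMap (F.map g) (Opposite.op j)) f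
    refine e1.symm.trans (congrArg (i.inv.app b) ?_)
    exact e2
  have hx' : ∀ {j k : J} (p : k ⟶ j) {a : C} (f : d.obj j ⟶ a), x k (d.map p ≫ f) = x j f := by
    intro j k p a f
    exact congrArg (i.inv.app a) (ConcreteCategory.congr_hom (colimit.w (F.obj a) p.op) f)
  let c : Cone (d ⋙ y) :=
    { pt := Z
      π :=
        { app j := θ.symm (x j (𝟙 _))
          naturality j k p := by
            change 𝟙 Z ≫ _ = _ ≫ y.map (d.map p)
            rw [Category.id_comp]
            apply θ.injective
            change θ (θ.symm (x k (𝟙 _))) = θ (θ.symm (x j (𝟙 _)) ≫ y.map (d.map p))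
            rw [h1, Equiv.apply_symm_apply, Equiv.apply_symm_apply, hx, ← hx' p]
            simp } }
  have hc : ∀ (j : J) {a : C} (f : d.obj j ⟶ a), θ (c.π.app j ≫ y.map f) = x j f := by
    intro j a f
    change θ (θ.symm (x j (𝟙 _)) ≫ y.map f) = x j f
    rw [h1, Equiv.apply_symm_apply, hx, Category.id_comp]
  have := hy.full
  refine ⟨c, fun {a} g => ?_, fun {a j} h h' hh => ?_⟩
  · obtain ⟨j, f, hf⟩ := Types.jointly_surjective' (i.hom.app a (θ g))
    refine ⟨j.unop, y.map f, θ.injective ?_⟩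
    change θ (c.π.app j.unop ≫ y.map f) = _
    rw [hc]
    change i.inv.app a (colimit.ι (F.obj a) j f) = _
    rw [hf]
    exact ConcreteCategory.congr_hom (i.hom_inv_id_app a) (θ g)
  · obtain ⟨f, rfl⟩ := y.map_surjective h
    obtain ⟨f', rfl⟩ := y.map_surjective h'
    have h4 : x j f = x j f' := by
      rw [← hc, ← hc]
      exact congrArg θ hh
    have h5 : colimit.ι (F.obj a) (Opposite.op j) f = colimit.ι (F.obj a) (Opposite.op j) f' := by
      have := congrArg (i.hom.app a) h4
      exact ((ConcreteCategory.congr_hom (i.inv_hom_id_app a) _).symm.trans this).trans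
        (ConcreteCategory.congr_hom (i.inv_hom_id_app a) _)
    obtain ⟨k, p, hp⟩ := (Types.FilteredColimit.isColimit_eq_iff' (colimit.isColimit (F.obj a))
      (i := Opposite.op j) f f').1 h5
    refine ⟨k.unop, p.unop, ?_⟩
    change y.map (d.map p.unop) ≫ y.map f = y.map (d.map p.unop) ≫ y.map f'
    rw [← y.map_comp, ← y.map_comp]
    exact congrArg y.map hp

/-- Comma categories of extensions are only essentially small, so the cone is built over a small
model and carried back along the equivalence. -/
theorem exists_isAccessibleCone (hy : IsProCompletion y) {J : Type*} [Category* J]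
    [IsCofiltered J] [EssentiallySmall.{u} J] (d : J ⥤ C) :
    ∃ c : Cone (d ⋙ y), IsAccessibleCone y c := by
  let ψ := equivSmallModel.{u} J
  have : IsCofiltered (SmallModel.{u} J) := IsCofiltered.of_equivalence ψ
  obtain ⟨c, hc⟩ := hy.exists_isAccessibleCone_of_small (ψ.inverse ⋙ d)
  let c' : Cone (d ⋙ y) :=
    { pt := c.pt
      π :=
        { app j := c.π.app (ψ.functor.obj j) ≫ y.map (d.map (ψ.unitInv.app j))
          naturality j k f := by
            have h1 := c.w (ψ.functor.map f)
            change 𝟙 _ ≫ _ = (_ ≫ _) ≫ y.map (d.map f)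
            rw [Category.id_comp, ← h1, Category.assoc, Category.assoc]
            congr 1
            change y.map (d.map _) ≫ _ = _
            rw [← y.map_comp, ← y.map_comp, ← d.map_comp, ← d.map_comp]
            congr 2
            exact ψ.unitInv.naturality f } }
  have hc' : ∀ (j : SmallModel.{u} J), c'.π.app (ψ.inverse.obj j) = c.π.app j := fun j => by
    change c.π.app _ ≫ y.map (d.map _) = _
    have h1 : _ = c.π.app (ψ.functor.obj (ψ.inverse.obj j)) := c.w (ψ.counitInv.app j)
    rw [← h1, Category.assoc]
    change c.π.app j ≫ y.map (d.map _) ≫ y.map (d.map _) = _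
    rw [← y.map_comp, ← d.map_comp]
    simp
  refine ⟨c', fun {a} g => ?_, fun {a j} h h' hh => ?_⟩
  · obtain ⟨j, h, hj⟩ := hc.exists_fac g
    exact ⟨ψ.inverse.obj j, h, by rw [hc']; exact hj⟩
  · change (c.π.app (ψ.functor.obj j) ≫ y.map (d.map (ψ.unitInv.app j))) ≫ h =
      (c.π.app (ψ.functor.obj j) ≫ y.map (d.map (ψ.unitInv.app j))) ≫ h' at hh
    rw [Category.assoc, Category.assoc] at hh
    obtain ⟨k, p, hp⟩ := hc.exists_eq _ _ hh
    refine ⟨ψ.inverse.obj k, ψ.inverse.map p ≫ ψ.unitInv.app j, ?_⟩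
    change y.map (d.map _) ≫ _ = y.map (d.map _) ≫ _
    rw [d.map_comp, y.map_comp, Category.assoc, Category.assoc]
    exact hp

end IsProCompletion

end ProCompletion

/-- A functor can be transported along any isomorphisms of its values. Injectivity of `α` ensures
that at most one value is prescribed at each object. This upgrades agreement with `F` from
isomorphism to equality. -/
theorem CategoryTheory.Functor.exists_iso_obj_eq {A C I : Type*} [Category* A] [Category* C]
    (α : I → A) (hα : Function.Injective α) (F : I → C) (K : A ⥤ C)
    (k : ∀ x, F x ≅ K.obj (α x)) :
    ∃ (K' : A ⥤ C) (e : K' ≅ K), ∀ x, ∃ h : K'.obj (α x) = F x,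
      e.hom.app (α x) = eqToHom h ≫ (k x).hom := by
  have H : ∀ b : A, ∃ (o : C) (e : K.obj b ≅ o), ∀ (x : I) (hx : α x = b),
      ∃ h : o = F x, e.inv = eqToHom h ≫ (k x).hom ≫ eqToHom (congrArg K.obj hx) := by
    intro b
    by_cases hb : ∃ x, α x = b
    · obtain ⟨x, rfl⟩ := hb
      refine ⟨F x, (k x).symm, fun x' hx' => ?_⟩
      obtain rfl := hα hx'
      exact ⟨rfl, by simp⟩
    · exact ⟨K.obj b, Iso.refl _, fun x hx => (hb ⟨x, hx⟩).elim⟩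
  choose o e he using H
  refine ⟨K.copyObj o e, (K.isoCopyObj o e).symm, fun x => ?_⟩
  obtain ⟨h, h'⟩ := he (α x) x rfl
  exact ⟨h, h'.trans (by rw [eqToHom_refl, Category.comp_id]; rfl)⟩

/-! ### Coinduced functors and factorization through functors with values in `C`. -/

section Uniformity

variable {A : Type} [SmallCategory A] [∀ a b : A, Finite (a ⟶ b)]
  {C : Type u} [Category.{v} C] [HasFiniteLimits C] {P : Type w} [Category.{w'} P]
  {I : Type} [Finite I]

/-- The functor coinduced from a finite family of objects `c i` placed at `a i`. -/
noncomputable def coinduced (a : I → A) (c : I → C) : A ⥤ C where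
  obj b := ∏ᶜ fun p : (Σ i, (b ⟶ a i)) => c p.1
  map f := Pi.lift fun q => Pi.π (fun p : (Σ i, (_ ⟶ a i)) => c p.1) ⟨q.1, f ≫ q.2⟩
  map_id b := by
    apply Pi.hom_ext
    rintro ⟨i, g⟩
    rw [Pi.lift_π, Category.id_comp, Category.id_comp]
  map_comp f g := by
    apply Pi.hom_ext
    rintro ⟨i, g⟩
    rw [Pi.lift_π, Category.assoc (Pi.lift _), Pi.lift_π, Pi.lift_π, Category.assoc]

/-- The projections of a coinduced functor. -/
noncomputable def coinducedπ (a : I → A) (c : I → C) {b : A} {i : I} (f : b ⟶ a i) :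
    (coinduced a c).obj b ⟶ c i :=
  Pi.π (fun p : (Σ i, (b ⟶ a i)) => c p.1) ⟨i, f⟩

theorem coinduced_map_π (a : I → A) (c : I → C) {b b' : A} {i : I} (g : b ⟶ b') (f : b' ⟶ a i) :
    (coinduced a c).map g ≫ coinducedπ a c f = coinducedπ a c (g ≫ f) :=
  Pi.lift_π _ _

/-- The universal property of coinduction, valid after `y` because the products involved are finite
and hence preserved by `y`. -/
theorem exists_map_coinduced (y : C ⥤ P) [PreservesFiniteLimits y] (a : I → A) (c : I → C)
    (N : A ⥤ P) (h : ∀ i, N.obj (a i) ⟶ y.obj (c i)) :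
    ∃ l : N ⟶ coinduced a c ⋙ y, ∀ (b : A) (i : I) (f : b ⟶ a i),
      l.app b ≫ y.map (coinducedπ a c f) = N.map f ≫ h i := by
  have hl : ∀ b, IsLimit (y.mapCone (limit.cone
      (Discrete.functor fun p : (Σ i, (b ⟶ a i)) => c p.1))) := fun b =>
    isLimitOfPreserves y (limit.isLimit _)
  let s : ∀ b, Cone ((Discrete.functor fun p : (Σ i, (b ⟶ a i)) => c p.1) ⋙ y) := fun b =>
    { pt := N.obj b
      π := Discrete.natTrans fun p => N.map p.as.2 ≫ h p.as.1 }
  have fac : ∀ (b : A) (i : I) (f : b ⟶ a i),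
      (hl b).lift (s b) ≫ y.map (coinducedπ a c f) = N.map f ≫ h i := fun b i f =>
    (hl b).fac (s b) ⟨⟨i, f⟩⟩
  refine ⟨⟨fun b => (hl b).lift (s b), fun b b' g => ?_⟩, fac⟩
  refine (hl b').hom_ext ?_
  rintro ⟨i, f⟩
  change (N.map g ≫ (hl b').lift (s b')) ≫ y.map (coinducedπ a c f) =
    ((hl b).lift (s b) ≫ y.map ((coinduced a c).map g)) ≫ y.map (coinducedπ a c f)
  have h1 : y.map ((coinduced a c).map g) ≫ y.map (coinducedπ a c f) =
      y.map (coinducedπ a c (g ≫ f)) := by rw [← y.map_comp, coinduced_map_π]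
  refine (Category.assoc _ _ _).trans (Eq.trans ?_ (Category.assoc _ _ _).symm)
  refine (congrArg (N.map g ≫ ·) (fac b' i f)).trans (Eq.trans ?_
    ((congrArg ((hl b).lift (s b) ≫ ·) h1).trans (fac b i (g ≫ f))).symm)
  rw [N.map_comp, Category.assoc]

theorem coinduced_hom_ext (y : C ⥤ P) [PreservesFiniteLimits y] (a : I → A) (c : I → C)
    {Z : P} {b : A} {l l' : Z ⟶ y.obj ((coinduced a c).obj b)}
    (h : ∀ (i : I) (f : b ⟶ a i),
      l ≫ y.map (coinducedπ a c f) = l' ≫ y.map (coinducedπ a c f)) : l = l' := by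
  have hl : IsLimit (y.mapCone (limit.cone
      (Discrete.functor fun p : (Σ i, (b ⟶ a i)) => c p.1))) :=
    isLimitOfPreserves y (limit.isLimit _)
  refine hl.hom_ext ?_
  rintro ⟨i, f⟩
  exact h i f

theorem exists_map_coinduced' (a : I → A) (c : I → C) (N : A ⥤ C) (h : ∀ i, N.obj (a i) ⟶ c i) :
    ∃ l : N ⟶ coinduced a c, ∀ (b : A) (i : I) (f : b ⟶ a i),
      l.app b ≫ coinducedπ a c f = N.map f ≫ h i :=
  exists_map_coinduced (𝟭 C) a c N h

variable (y : C ⥤ P) [PreservesFiniteLimits y]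

/-- A transformation from `G` to a functor with values in `C` factors through a functor `K` with
values in `C` that agrees with `G` at finitely many objects where the values of `G` lie in `C`. -/
theorem exists_factor_iso [y.Full] [y.Faithful] (α : I → A) (F : I → C) (G : A ⥤ P)
    (φ : ∀ x, G.obj (α x) ≅ y.obj (F x)) (N : A ⥤ C) (τ : G ⟶ N ⋙ y) :
    ∃ (K : A ⥤ C) (t : G ⟶ K ⋙ y) (s : K ⟶ N) (k : ∀ x, F x ≅ K.obj (α x)),
      t ≫ Functor.whiskerRight s y = τ ∧ ∀ x, t.app (α x) = (φ x).hom ≫ y.map (k x).hom := by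
  let Y : (A ⥤ C) ⥤ (A ⥤ P) := (Functor.whiskeringRight A C P).obj y
  have hY : PreservesFiniteLimits Y := ⟨fun _ _ _ => inferInstance⟩
  obtain ⟨ρ, hρ⟩ := exists_map_coinduced y α F G (fun x => (φ x).hom)
  -- Multiplying `N` by `R` produces a retraction `r x` onto `F x`, with section `σ x` obtained from
  -- `G`. The composite `r x ≫ σ x` is then an idempotent on `N1` at `α x` that leaves `τ1`
  -- unchanged.
  let R := coinduced α F
  let N1 : A ⥤ C := N ⨯ R
  let p1 : N1 ⟶ N := prod.fst
  let p2 : N1 ⟶ R := prod.snd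
  obtain ⟨τ1, h1, h2⟩ : ∃ τ1 : G ⟶ Y.obj N1, τ1 ≫ Y.map p1 = τ ∧ τ1 ≫ Y.map p2 = ρ := by
    have hl := mapIsLimitOfPreservesOfIsLimit Y p1 p2 (prodIsProd N R)
    obtain ⟨l, hl1, hl2⟩ := BinaryFan.IsLimit.lift' hl τ ρ
    exact ⟨l, hl1, hl2⟩
  have h2' : ∀ x, τ1.app (α x) ≫ y.map (p2.app (α x)) = ρ.app (α x) := fun x =>
    NatTrans.congr_app h2 (α x)
  let r : ∀ x, N1.obj (α x) ⟶ F x := fun x => p2.app (α x) ≫ coinducedπ α F (𝟙 (α x))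
  have hr : ∀ x, τ1.app (α x) ≫ y.map (r x) = (φ x).hom := fun x => by
    rw [y.map_comp, ← Category.assoc, h2', hρ, G.map_id, Category.id_comp]
  let σ : ∀ x, F x ⟶ N1.obj (α x) := fun x => y.preimage ((φ x).inv ≫ τ1.app (α x))
  have hσ : ∀ x, y.map (σ x) = (φ x).inv ≫ τ1.app (α x) := fun x => y.map_preimage _
  have hσr : ∀ x, σ x ≫ r x = 𝟙 _ := fun x => y.map_injective (by
    rw [y.map_comp, hσ, Category.assoc, hr, Iso.inv_hom_id, y.map_id])
  have he : ∀ x, τ1.app (α x) ≫ y.map (r x ≫ σ x) = τ1.app (α x) := fun x => by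
    rw [y.map_comp, ← Category.assoc, hr, hσ, Iso.hom_inv_id_assoc]
  -- The transposes of the identities and of the idempotents. Their equalizer is the largest part of
  -- `N1` on which every idempotent acts trivially, so its value at `α x` is `F x` up to
  -- isomorphism, and `τ1` factors through it.
  obtain ⟨a, ha⟩ := exists_map_coinduced' α (fun x => N1.obj (α x)) N1 (fun x => 𝟙 _)
  obtain ⟨b, hb⟩ := exists_map_coinduced' α (fun x => N1.obj (α x)) N1 (fun x => r x ≫ σ x)
  have hab : τ1 ≫ Y.map a = τ1 ≫ Y.map b := by
    ext d
    apply coinduced_hom_ext y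
    intro x f
    change (τ1.app d ≫ y.map (a.app d)) ≫ _ = (τ1.app d ≫ y.map (b.app d)) ≫ _
    have hn : τ1.app d ≫ y.map (N1.map f) = G.map f ≫ τ1.app (α x) := (τ1.naturality f).symm
    rw [Category.assoc, Category.assoc, ← y.map_comp, ← y.map_comp, ha, hb, Category.comp_id,
      y.map_comp, ← Category.assoc, hn, Category.assoc, he]
  let K : A ⥤ C := equalizer a b
  let ι : K ⟶ N1 := equalizer.ι a b
  obtain ⟨t, ht⟩ : ∃ t : G ⟶ Y.obj K, t ≫ Y.map ι = τ1 := by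
    have hl := isLimitForkMapOfIsLimit Y (equalizer.condition a b) (equalizerIsEqualizer a b)
    exact ⟨hl.lift (Fork.ofι τ1 hab), hl.fac _ WalkingParallelPair.zero⟩
  have ht' : ∀ d, t.app d ≫ y.map (ι.app d) = τ1.app d := fun d => NatTrans.congr_app ht d
  let k : ∀ x, F x ⟶ K.obj (α x) := fun x => y.preimage ((φ x).inv ≫ t.app (α x))
  have hk : ∀ x, y.map (k x) = (φ x).inv ≫ t.app (α x) := fun x => y.map_preimage _
  have hkι : ∀ x, k x ≫ ι.app (α x) = σ x := fun x => y.map_injective (by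
    rw [y.map_comp, hk, hσ, Category.assoc, ht'])
  have hιe : ∀ x, ι.app (α x) ≫ r x ≫ σ x = ι.app (α x) := fun x => by
    have h3 : ι.app (α x) ≫ a.app (α x) = ι.app (α x) ≫ b.app (α x) :=
      NatTrans.congr_app (equalizer.condition a b) (α x)
    have h4 := congrArg (· ≫ coinducedπ α (fun x => N1.obj (α x)) (𝟙 (α x))) h3
    simp only [Category.assoc, ha, hb, N1.map_id, Category.id_comp, Category.comp_id] at h4
    exact h4.symm
  have hmono : ∀ d, Mono (ι.app d) := fun d => (NatTrans.mono_iff_mono_app ι).1 inferInstance d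
  refine ⟨K, t, ι ≫ p1, fun x => ⟨k x, ι.app (α x) ≫ r x, ?_, ?_⟩, ?_, fun x => ?_⟩
  · rw [← Category.assoc, hkι, hσr]
  · rw [← cancel_mono (ι.app (α x)), Category.assoc, Category.assoc, hkι, hιe, Category.id_comp]
  · change t ≫ Y.map (ι ≫ p1) = τ
    rw [Y.map_comp, ← Category.assoc, ht, h1]
  · change _ = _ ≫ y.map (k x)
    rw [hk, Iso.hom_inv_id_assoc]

/-- Strict version of `exists_factor_iso`. -/
theorem exists_factor [y.Full] [y.Faithful] (α : I → A) (hα : Function.Injective α) (F : I → C)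
    (G : A ⥤ P) (φ : ∀ x, G.obj (α x) ≅ y.obj (F x)) (N : A ⥤ C) (τ : G ⟶ N ⋙ y) :
    ∃ (K : A ⥤ C) (t : G ⟶ K ⋙ y) (s : K ⟶ N) (h : ∀ x, F x = K.obj (α x)),
      t ≫ Functor.whiskerRight s y = τ ∧
        ∀ x, t.app (α x) = (φ x).hom ≫ eqToHom (congrArg y.obj (h x)) := by
  obtain ⟨K, t, s, k, h1, h2⟩ := exists_factor_iso y α F G φ N τ
  obtain ⟨K', e, he⟩ := CategoryTheory.Functor.exists_iso_obj_eq α hα F K k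
  refine ⟨K', t ≫ Functor.whiskerRight e.inv y, e.hom ≫ s, fun x => (he x).choose.symm, ?_,
    fun x => ?_⟩
  · rw [← h1, Functor.whiskerRight_comp, Category.assoc, ← Functor.whiskerRight_comp_assoc]
    simp
  · obtain ⟨h, h'⟩ := he x
    have h3 : (k x).hom = eqToHom h.symm ≫ e.hom.app (α x) := by simp [h']
    change t.app (α x) ≫ y.map (e.inv.app (α x)) = _
    rw [h2, h3, Category.assoc, ← y.map_comp, Category.assoc, Iso.hom_inv_id_app,
      Category.comp_id, eqToHom_map]

variable {y} in
-- The ambient comma category has finite limits, because `y` preserves them, so it is cofiltered;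
-- `J` inherits this as a full subcategory with an object over every object. An arrow `G a ⟶ y c`
-- transposes to a map from `G` to a coinduced functor, that is, to an object of the comma category,
-- and an equality after a leg becomes a parallel pair there.
theorem exists_factor_of_coinduced {J : Type*} [Category* J] {G : A ⥤ P}
    (Ψ : J ⥤ StructuredArrow G ((Functor.whiskeringRight A C P).obj y)) [Ψ.Full] [Ψ.Faithful]
    (hΨ : ∀ X, ∃ j, Nonempty (Ψ.obj j ⟶ X)) :
    IsCofiltered J ∧ ∀ (a : A) (c : C),
      (∀ g : G.obj a ⟶ y.obj c, ∃ (j : J) (h : (Ψ.obj j).right.obj a ⟶ c),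
        (Ψ.obj j).hom.app a ≫ y.map h = g) ∧
      (∀ (j : J) (h h' : (Ψ.obj j).right.obj a ⟶ c),
        (Ψ.obj j).hom.app a ≫ y.map h = (Ψ.obj j).hom.app a ≫ y.map h' →
          ∃ (k : J) (f : k ⟶ j), (Ψ.map f).right.app a ≫ h = (Ψ.map f).right.app a ≫ h') := by
  have hY : PreservesFiniteLimits ((Functor.whiskeringRight A C P).obj y) :=
    ⟨fun _ _ _ => inferInstance⟩
  have hlim : HasFiniteLimits (StructuredArrow G ((Functor.whiskeringRight A C P).obj y)) :=
    ⟨fun _ _ _ => inferInstance⟩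
  have hcof : IsCofiltered (StructuredArrow G ((Functor.whiskeringRight A C P).obj y)) :=
    IsCofiltered.of_hasFiniteLimits _
  refine ⟨IsCofiltered.of_exists_of_isCofiltered_of_fullyFaithful Ψ hΨ, fun a c =>
    ⟨fun g => ?_, fun j h h' hh => ?_⟩⟩
  · obtain ⟨l, hl⟩ := exists_map_coinduced y (fun _ : Unit => a) (fun _ => c) G (fun _ => g)
    obtain ⟨j, ⟨f⟩⟩ := hΨ (StructuredArrow.mk
      (T := (Functor.whiskeringRight A C P).obj y) (Y := coinduced (fun _ : Unit => a) fun _ => c) l)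
    refine ⟨j, f.right.app a ≫ coinducedπ (fun _ : Unit => a) (fun _ => c) (i := ()) (𝟙 a), ?_⟩
    have h1 : (Ψ.obj j).hom.app a ≫ y.map (f.right.app a) = l.app a :=
      NatTrans.congr_app (StructuredArrow.w f) a
    rw [y.map_comp, ← Category.assoc, h1, hl, G.map_id, Category.id_comp]
  · obtain ⟨l, hl⟩ := exists_map_coinduced' (fun _ : Unit => a) (fun _ => c) _ (fun _ => h)
    obtain ⟨l', hl'⟩ := exists_map_coinduced' (fun _ : Unit => a) (fun _ => c) _ (fun _ => h')
    have e : (Ψ.obj j).hom ≫ Functor.whiskerRight l y =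
        (Ψ.obj j).hom ≫ Functor.whiskerRight l' y := by
      ext d
      apply coinduced_hom_ext y
      intro i f
      change ((Ψ.obj j).hom.app d ≫ y.map (l.app d)) ≫ _ =
        ((Ψ.obj j).hom.app d ≫ y.map (l'.app d)) ≫ _
      have hn : (Ψ.obj j).hom.app d ≫ y.map ((Ψ.obj j).right.map f) =
        G.map f ≫ (Ψ.obj j).hom.app a := ((Ψ.obj j).hom.naturality f).symm
      rw [Category.assoc, Category.assoc, ← y.map_comp, ← y.map_comp, hl, hl', y.map_comp,
        y.map_comp, ← Category.assoc, hn, Category.assoc, hh, ← Category.assoc, ← hn,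
        Category.assoc]
    -- Because of `e`, this one object is a common target making `l` and `l'` parallel arrows of the
    -- comma category.
    let X := StructuredArrow.mk (T := (Functor.whiskeringRight A C P).obj y)
      ((Ψ.obj j).hom ≫ Functor.whiskerRight l y)
    let p : Ψ.obj j ⟶ X := StructuredArrow.homMk l rfl
    let p' : Ψ.obj j ⟶ X := StructuredArrow.homMk l' e.symm
    obtain ⟨k, ⟨f⟩⟩ := hΨ (IsCofiltered.eq p p')
    refine ⟨k, Ψ.preimage (f ≫ IsCofiltered.eqHom p p'), ?_⟩
    have h1 : (f ≫ IsCofiltered.eqHom p p') ≫ p = (f ≫ IsCofiltered.eqHom p p') ≫ p' := by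
      rw [Category.assoc, Category.assoc, IsCofiltered.eq_condition]
    rw [Functor.map_preimage]
    have h2 : (f ≫ IsCofiltered.eqHom p p').right.app a ≫ l.app a =
        (f ≫ IsCofiltered.eqHom p p').right.app a ≫ l'.app a :=
      NatTrans.congr_app (congrArg (fun q => q.right) h1) a
    have h3 := congrArg (· ≫ coinducedπ (fun _ : Unit => a) (fun _ => c) (i := ()) (𝟙 a)) h2
    simp only [Category.assoc, hl, hl', CategoryTheory.Functor.map_id, Category.id_comp] at h3
    exact h3

end Uniformity

/-! ### Simultaneous refinement in cofiltered categories. -/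

section CofilteredRefinement

variable {J : Type*} [Category* J] [IsCofiltered J]

theorem IsCofiltered.exists_refinement {ι : Type*} [Finite ι] {k : J}
    (Q : ι → ∀ {m : J}, (m ⟶ k) → Prop)
    (hQ : ∀ (i : ι) {m n : J} (p : m ⟶ k) (q : n ⟶ m), Q i p → Q i (q ≫ p))
    (h : ∀ i, ∃ (m : J) (p : m ⟶ k), Q i p) : ∃ (m : J) (p : m ⟶ k), ∀ i, Q i p := by
  classical
  have := Fintype.ofFinite ι
  suffices H : ∀ s : Finset ι, ∃ (m : J) (p : m ⟶ k), ∀ i ∈ s, Q i p by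
    obtain ⟨m, p, hp⟩ := H Finset.univ
    exact ⟨m, p, fun i => hp i (Finset.mem_univ i)⟩
  intro s
  induction s using Finset.induction_on with
  | empty => exact ⟨k, 𝟙 k, by simp⟩
  | insert i s _ ih =>
    obtain ⟨m, p, hp⟩ := ih
    obtain ⟨n, q, hq⟩ := h i
    obtain ⟨l, f, g, hfg⟩ := IsCofiltered.cospan p q
    refine ⟨l, f ≫ p, fun i' hi' => ?_⟩
    rcases Finset.mem_insert.1 hi' with rfl | hi'
    · rw [hfg]
      exact hQ _ _ _ hq
    · exact hQ _ _ _ (hp i' hi')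

theorem IsCofiltered.exists_lower_bound {ι : Type*} [Finite ι] (j : ι → J) :
    ∃ k : J, ∀ i, Nonempty (k ⟶ j i) := by
  classical
  have := Fintype.ofFinite ι
  obtain ⟨k, hk⟩ := IsCofiltered.inf_objs_exists (Finset.univ.image j)
  exact ⟨k, fun i => hk (Finset.mem_image_of_mem j (Finset.mem_univ i))⟩

end CofilteredRefinement

/-! ### Vertexwise limits of structures. -/

namespace ExactnessSketch

variable {Z : ExactnessSketch} {P : Type w} [Category.{w'} P] {J : Type*} [Category* J]

/-- Evaluation of structures at a vertex. -/
def Str.eval (Z : ExactnessSketch) (P : Type w) [Category.{w'} P] (b : Z.V) : Z.Str P ⥤ P where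
  obj S := S.graph.obj b
  map m := m.app b
  map_id _ := rfl
  map_comp _ _ := rfl

/-- A graph over all the structures of a diagram `D` which is vertexwise a limit of `D`. -/
structure IsVertexwiseLimit (D : J ⥤ Z.Str P) (S : Z.V ⥤q P)
    (π : ∀ (b : Z.V) (j : J), S.obj b ⟶ (D.obj j).graph.obj b) : Prop where
  w : ∀ (b : Z.V) {j k : J} (q : j ⟶ k), π b j ≫ (D.map q).app b = π b k
  naturality : ∀ {a b : Z.V} (f : a ⟶ b) (j : J),
    S.map f ≫ π b j = π a j ≫ (D.obj j).graph.map f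
  exists_lift : ∀ (b : Z.V) {T : P} (x : ∀ j, T ⟶ (D.obj j).graph.obj b),
    (∀ {j k : J} (q : j ⟶ k), x j ≫ (D.map q).app b = x k) → ∃ f, ∀ j, f ≫ π b j = x j
  hom_ext : ∀ (b : Z.V) {T : P} (f g : T ⟶ S.obj b), (∀ j, f ≫ π b j = g ≫ π b j) → f = g

namespace IsVertexwiseLimit

variable {D : J ⥤ Z.Str P} {S : Z.V ⥤q P}
  {π : ∀ (b : Z.V) (j : J), S.obj b ⟶ (D.obj j).graph.obj b}

theorem composePath_π (hS : IsVertexwiseLimit D S π) {a b : Z.V} (p : Quiver.Path a b) (j : J) :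
    composePath (S.mapPath p) ≫ π b j = π a j ≫ composePath ((D.obj j).graph.mapPath p) := by
  induction p with
  | nil => exact (Category.id_comp _).trans (Category.comp_id _).symm
  | cons p e ih =>
    change (composePath (S.mapPath p) ≫ S.map e) ≫ _ =
      _ ≫ composePath ((D.obj j).graph.mapPath p) ≫ (D.obj j).graph.map e
    rw [Category.assoc, hS.naturality, ← Category.assoc, ih, Category.assoc]

/-- Limits commute with limits, whatever the shape of the diagram; cofilteredness and accessibility
matter only for colimit conditions. -/
theorem isLimiting (hS : IsVertexwiseLimit D S π) (t : ConeDatum Z.V)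
    (ht : ∀ j, (t.map (D.obj j).graph).IsLimiting) : (t.map S).IsLimiting := by
  obtain ⟨H, Δ, p, l⟩ := t
  have ht1 : ∀ (j : J) {h k : H.V} (e : h ⟶ k),
      (D.obj j).graph.map (l h) ≫ (D.obj j).graph.map (Δ.map e) = (D.obj j).graph.map (l k) :=
    fun j => (ht j).1
  have ht2 : ∀ (j : J) (T : P) (x : ∀ h : H.V, T ⟶ (D.obj j).graph.obj (Δ.obj h)),
      (∀ {h k : H.V} (e : h ⟶ k), x h ≫ (D.obj j).graph.map (Δ.map e) = x k) →
      ∃! f : T ⟶ (D.obj j).graph.obj p, ∀ h, f ≫ (D.obj j).graph.map (l h) = x h :=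
    fun j => (ht j).2
  constructor
  · intro (h : H.V) (k : H.V) (e : h ⟶ k)
    change S.map (l h) ≫ S.map (Δ.map e) = S.map (l k)
    refine hS.hom_ext _ _ _ fun j => ?_
    rw [Category.assoc, hS.naturality, ← Category.assoc, hS.naturality, Category.assoc, ht1,
      hS.naturality]
  · intro T x hx
    change ∀ h : H.V, T ⟶ S.obj (Δ.obj h) at x
    change ∀ {h k : H.V} (e : h ⟶ k), x h ≫ S.map (Δ.map e) = x k at hx
    change ∃! f : T ⟶ S.obj p, ∀ h : H.V, f ≫ S.map (l h) = x h
    have key := fun j => ht2 j T (fun h => x h ≫ π _ j) fun {h k} e => by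
      rw [← hx e, Category.assoc, Category.assoc, hS.naturality]
    choose g hg hg' using key
    obtain ⟨f, hf⟩ := hS.exists_lift p g fun {j k} q => by
      refine hg' k _ fun h => ?_
      have h2 := (D.map q).naturality (l h)
      rw [Category.assoc, ← h2, ← Category.assoc, hg, Category.assoc, hS.w]
    refine ⟨f, fun h => hS.hom_ext _ _ _ fun j => ?_, fun f' hf' => hS.hom_ext _ _ _ fun j => ?_⟩
    · rw [Category.assoc, hS.naturality, ← Category.assoc, hf, hg]
    · rw [hf]
      refine hg' j _ fun h => ?_
      rw [Category.assoc, ← hS.naturality, ← Category.assoc, hf']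

variable {C : Type u} [Category.{v} C] {y : C ⥤ P} [IsCofiltered J]

/-- Finite colimits commute with cofiltered limits that are accessible relative to a codense
functor. -/
theorem isColimiting (hS : IsVertexwiseLimit D S π) (hy : IsCodense y)
    (hfac : ∀ (b : Z.V) {a : C} (g : S.obj b ⟶ y.obj a), ∃ (j : J)
      (h : (D.obj j).graph.obj b ⟶ y.obj a), π b j ≫ h = g)
    (heq : ∀ (b : Z.V) {a : C} {j : J} (h h' : (D.obj j).graph.obj b ⟶ y.obj a),
      π b j ≫ h = π b j ≫ h' →
        ∃ (k : J) (f : k ⟶ j), (D.map f).app b ≫ h = (D.map f).app b ≫ h')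
    (t : CoconeDatum Z.V) (ht : ∀ j, (t.map (D.obj j).graph).IsColimiting) :
    (t.map S).IsColimiting := by
  obtain ⟨H, Δ, p, l⟩ := t
  have ht1 : ∀ (j : J) {h k : H.V} (e : h ⟶ k),
      (D.obj j).graph.map (Δ.map e) ≫ (D.obj j).graph.map (l k) = (D.obj j).graph.map (l h) :=
    fun j => (ht j).1
  have ht2 : ∀ (j : J) (T : P) (x : ∀ h : H.V, (D.obj j).graph.obj (Δ.obj h) ⟶ T),
      (∀ {h k : H.V} (e : h ⟶ k), (D.obj j).graph.map (Δ.map e) ≫ x k = x h) →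
      ∃! f : (D.obj j).graph.obj p ⟶ T, ∀ h, (D.obj j).graph.map (l h) ≫ f = x h :=
    fun j => (ht j).2
  have hDcomp : ∀ (b : Z.V) {i j k : J} (f : i ⟶ j) (g : j ⟶ k),
      (D.map (f ≫ g)).app b = (D.map f).app b ≫ (D.map g).app b := fun b i j k f g => by
    rw [D.map_comp]; rfl
  have hnat : ∀ {j k : J} (q : j ⟶ k) {a b : Z.V} (f : a ⟶ b),
      (D.obj j).graph.map f ≫ (D.map q).app b = (D.map q).app a ≫ (D.obj k).graph.map f :=
    fun q => (D.map q).naturality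
  -- Against a target `y a` both arrows factor through one stage. The finitely many equations over
  -- `H` hold together at a later stage, where the cocone is a genuine colimit.
  have uniq : ∀ {a : C} (f f' : S.obj p ⟶ y.obj a),
      (∀ h : H.V, S.map (l h) ≫ f = S.map (l h) ≫ f') → f = f' := by
    intro a f f' hff
    obtain ⟨j, g, rfl⟩ := hfac p f
    obtain ⟨j', g', rfl⟩ := hfac p f'
    obtain ⟨k, q, q', -⟩ := IsCofilteredOrEmpty.cone_objs j j'
    have e1 : ∀ h : H.V, ∃ (m : J) (r : m ⟶ k),
        (D.map r).app _ ≫ (D.obj k).graph.map (l h) ≫ (D.map q).app p ≫ g =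
          (D.map r).app _ ≫ (D.obj k).graph.map (l h) ≫ (D.map q').app p ≫ g' := by
      intro h
      apply heq
      have := hff h
      rwa [← hS.w p q, ← hS.w p q', Category.assoc, Category.assoc, ← Category.assoc (S.map (l h)),
        ← Category.assoc (S.map (l h)), hS.naturality, Category.assoc, Category.assoc] at this
    obtain ⟨m, r, hr⟩ := IsCofiltered.exists_refinement (k := k)
      (fun (h : H.V) {m} (r : m ⟶ k) =>
        (D.map r).app _ ≫ (D.obj k).graph.map (l h) ≫ (D.map q).app p ≫ g =
          (D.map r).app _ ≫ (D.obj k).graph.map (l h) ≫ (D.map q').app p ≫ g')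
      (fun h m n r s hr => by
        rw [hDcomp, Category.assoc, hr, Category.assoc]) e1
    have e2 : (D.map r).app p ≫ (D.map q).app p ≫ g = (D.map r).app p ≫ (D.map q').app p ≫ g' := by
      refine (ht2 m _ (fun h => (D.map r).app _ ≫ (D.obj k).graph.map (l h) ≫
        (D.map q).app p ≫ g) fun {h h'} e => ?_).unique (fun h => ?_) (fun h => ?_)
      · rw [← Category.assoc, hnat, Category.assoc,
          ← Category.assoc ((D.obj k).graph.map (Δ.map e)), ht1]
      · rw [← Category.assoc, hnat, Category.assoc]
      · rw [hr, ← Category.assoc, hnat, Category.assoc]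
    rw [← hS.w p q, ← hS.w p q', ← hS.w p r, Category.assoc, Category.assoc, e2, Category.assoc,
      Category.assoc]
  -- Likewise, finiteness of the vertices and arrows of `H` lets a cocone with vertex `y a` descend
  -- to a compatible cocone at a single stage.
  have exist : ∀ {a : C} (x : ∀ h : H.V, S.obj (Δ.obj h) ⟶ y.obj a),
      (∀ {h k : H.V} (e : h ⟶ k), S.map (Δ.map e) ≫ x k = x h) →
      ∃ f : S.obj p ⟶ y.obj a, ∀ h, S.map (l h) ≫ f = x h := by
    intro a x hx
    choose j x1 hx1 using fun h => hfac _ (x h)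
    obtain ⟨k, hk⟩ := IsCofiltered.exists_lower_bound j
    let x2 : ∀ h, (D.obj k).graph.obj (Δ.obj h) ⟶ y.obj a := fun h =>
      (D.map (hk h).some).app _ ≫ x1 h
    have hx2 : ∀ h, π _ k ≫ x2 h = x h := fun h => by
      rw [← Category.assoc, hS.w, hx1]
    obtain ⟨m, r, hr⟩ := IsCofiltered.exists_refinement (k := k)
      (fun (e : Σ h : H.V, Σ h' : H.V, (h ⟶ h')) {m} (r : m ⟶ k) =>
        (D.map r).app _ ≫ (D.obj k).graph.map (Δ.map e.2.2) ≫ x2 e.2.1 =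
          (D.map r).app _ ≫ x2 e.1)
      (fun e m n r s hr => by
        rw [hDcomp, Category.assoc, hr, Category.assoc])
      (fun e => by
        apply heq
        rw [← Category.assoc, ← hS.naturality, Category.assoc, hx2, hx2, hx])
    obtain ⟨f, hf, -⟩ := ht2 m _ (fun h => (D.map r).app _ ≫ x2 h) fun {h h'} e => by
      rw [← Category.assoc, hnat, Category.assoc]
      exact hr ⟨h, h', e⟩
    refine ⟨π p m ≫ f, fun h => ?_⟩
    rw [← Category.assoc, hS.naturality, Category.assoc, hf, ← Category.assoc, hS.w, hx2]
  constructor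
  · intro (h : H.V) (k : H.V) (e : h ⟶ k)
    change S.map (Δ.map e) ≫ S.map (l k) = S.map (l h)
    refine hS.hom_ext _ _ _ fun j => ?_
    rw [Category.assoc, hS.naturality, ← Category.assoc, hS.naturality, Category.assoc, ht1,
      hS.naturality]
  · intro T x hx
    change ∀ h : H.V, S.obj (Δ.obj h) ⟶ T at x
    change ∀ {h k : H.V} (e : h ⟶ k), S.map (Δ.map e) ≫ x k = x h at hx
    change ∃! f : S.obj p ⟶ T, ∀ h : H.V, S.map (l h) ≫ f = x h
    -- For an arbitrary target `T`, the induced arrows into the objects `y a` form a natural family,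
    -- which codensity assembles into one arrow.
    choose φ hφ using fun (a : C) (g : T ⟶ y.obj a) => exist (fun h => x h ≫ g)
      (fun {h k} e => by rw [← Category.assoc, hx])
    obtain ⟨m, hm, -⟩ := hy T (S.obj p) φ fun {a b} f g => uniq _ _ fun h => by
      rw [hφ, ← Category.assoc (S.map (l h)), hφ, Category.assoc]
    refine ⟨m, fun h => hy.hom_ext fun a g => ?_, fun f hf => hy.hom_ext fun a g => ?_⟩
    · rw [Category.assoc, hm, hφ]
    · rw [hm]
      refine uniq _ _ fun h => ?_
      rw [hφ, ← Category.assoc, hf]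

end IsVertexwiseLimit

variable {C : Type u} [Category.{v} C] {y : C ⥤ P} [IsCofiltered J] {D : J ⥤ Z.Str P}

/-- The structure with underlying objects the apices of vertexwise accessible cones. -/
theorem exists_limit_structure (hy : IsCodense y) {c : ∀ b, Cone (D ⋙ Str.eval Z P b)}
    (ha : ∀ b, IsAccessibleCone y (c b)) :
    ∃ (S : Z.V ⥤q P) (hS : ∀ b, (c b).pt = S.obj b)
      (π : ∀ (b : Z.V) (j : J), S.obj b ⟶ (D.obj j).graph.obj b)
      (S' : Z.Str P),
      IsVertexwiseLimit D S π ∧ S'.graph = S ∧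
      ∀ b j, (c b).π.app j = eqToHom (hS b) ≫ π b j := by
  have hc : ∀ b, IsLimit (c b) := fun b => ((ha b).nonempty_isLimit hy).some
  let π : ∀ (b : Z.V) (j : J), (c b).pt ⟶ (D.obj j).graph.obj b := fun b j => (c b).π.app j
  have hw : ∀ (b : Z.V) {j k : J} (q : j ⟶ k), π b j ≫ (D.map q).app b = π b k :=
    fun b j k q => (c b).w q
  have hlift : ∀ (b : Z.V) {T : P} (x : ∀ j, T ⟶ (D.obj j).graph.obj b),
      (∀ {j k : J} (q : j ⟶ k), x j ≫ (D.map q).app b = x k) → ∃ f, ∀ j, f ≫ π b j = x j := by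
    intro b T x hx
    let s : Cone (D ⋙ Str.eval Z P b) :=
      { pt := T
        π :=
          { app := x
            naturality j k q := (Category.id_comp _).trans (hx q).symm } }
    exact ⟨(hc b).lift s, fun j => (hc b).fac s j⟩
  have hmap : ∀ {a b : Z.V} (f : a ⟶ b), ∃ l : (c a).pt ⟶ (c b).pt, ∀ j,
      l ≫ π b j = π a j ≫ (D.obj j).graph.map f := fun {a b} f =>
    hlift b (fun j => π a j ≫ (D.obj j).graph.map f) fun {j k} q => by
      have h2 := (D.map q).naturality f
      rw [Category.assoc, h2, ← Category.assoc, hw]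
  choose map hmap using @hmap
  have hS : IsVertexwiseLimit D ⟨fun b => (c b).pt, fun {a b} f => map f⟩ π :=
    ⟨hw, hmap, hlift, fun b T f g h => (hc b).hom_ext h⟩
  exact ⟨_, fun _ => rfl, π,
    { graph := _
      comm := fun p q h => hS.hom_ext _ _ _ fun j => by
        rw [hS.composePath_π, hS.composePath_π, (D.obj j).comm p q h]
      lim := fun t h => hS.isLimiting t fun j => (D.obj j).lim t h
      colim := fun t h => hS.isColimiting hy (fun b => (ha b).exists_fac)
        (fun b => (ha b).exists_eq) t fun j => (D.obj j).colim t h },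
    hS, rfl, fun b j => (Category.id_comp _).symm⟩

end ExactnessSketch

/-! ### Invariance of convergence conditions under isomorphism of shapes. -/

theorem Prefunctor.ext_of_eqToHom {V : Type*} [Quiver V] {D : Type*} [Category* D] {F G : V ⥤q D}
    (hobj : ∀ a, F.obj a = G.obj a)
    (hmap : ∀ {a b : V} (f : a ⟶ b),
      F.map f = eqToHom (hobj a) ≫ G.map f ≫ eqToHom (hobj b).symm) : F = G := by
  obtain ⟨Fo, Fm⟩ := F
  obtain ⟨Go, Gm⟩ := G
  obtain rfl : Fo = Go := funext hobj
  congr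
  funext a b f
  simpa using hmap f

theorem ConeDatum.isLimiting_reindex_map {W : Type*} [Quiver W] {C : Type*} [Category* C]
    (t' : ConeDatum W) (H : FiniteGraph) (I : H.V ⥤q t'.shape.V) (J : t'.shape.V ⥤q H.V)
    (hIJ : I ⋙q J = 𝟭q _) (hJI : J ⋙q I = 𝟭q _) (φ : W ⥤q C) (ht' : (t'.map φ).IsLimiting) :
    ((t'.reindex H I).map φ).IsLimiting := by
  obtain ⟨H', Δ', p', l'⟩ := t'
  refine ⟨fun {h k} e => ht'.1 (I.map e), fun T x hx => ?_⟩
  -- The composite `J ⋙q I` is generalized to a variable `E` so that its equality with the identity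
  -- can be substituted despite the dependent types.
  have key : ∀ (E : H'.V ⥤q H'.V), E = 𝟭q _ →
      ∀ x : ∀ h, T ⟶ φ.obj (Δ'.obj (E.obj h)),
      (∀ {h k : H'.V} (e : h ⟶ k), x h ≫ φ.map (Δ'.map (E.map e)) = x k) →
      ∃! f : T ⟶ φ.obj p', ∀ h, f ≫ φ.map (l' (E.obj h)) = x h := by
    rintro _ rfl x hx
    exact ht'.2 T x hx
  obtain ⟨f, hf, hf'⟩ := key (J ⋙q I) hJI (fun h => x (J.obj h)) fun e => hx (J.map e)
  refine ⟨f, fun h => ?_, fun g hg => hf' g fun h => hg (J.obj h)⟩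
  have hh : J.obj (I.obj h) = h := congrArg (fun E : H.V ⥤q H.V => E.obj h) hIJ
  exact Eq.subst (motive := fun z => f ≫ φ.map (l' (I.obj z)) = x z) hh (hf (I.obj h))

theorem ConeDatum.Equivalent.isLimiting_map {W : Type*} [Quiver W] {C : Type*} [Category* C]
    {t t' : ConeDatum W} (h : t.Equivalent t') (φ : W ⥤q C) (ht' : (t'.map φ).IsLimiting) :
    (t.map φ).IsLimiting := by
  obtain ⟨I, J, hIJ, hJI, e⟩ := h
  rw [e]
  exact t'.isLimiting_reindex_map _ I J hIJ hJI φ ht'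

theorem CoconeDatum.isColimiting_reindex_map {W : Type*} [Quiver W] {C : Type*} [Category* C]
    (t' : CoconeDatum W) (H : FiniteGraph) (I : H.V ⥤q t'.shape.V) (J : t'.shape.V ⥤q H.V)
    (hIJ : I ⋙q J = 𝟭q _) (hJI : J ⋙q I = 𝟭q _) (φ : W ⥤q C) (ht' : (t'.map φ).IsColimiting) :
    ((t'.reindex H I).map φ).IsColimiting := by
  obtain ⟨H', Δ', p', l'⟩ := t'
  refine ⟨fun {h k} e => ht'.1 (I.map e), fun T x hx => ?_⟩
  have key : ∀ (E : H'.V ⥤q H'.V), E = 𝟭q _ →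
      ∀ x : ∀ h, φ.obj (Δ'.obj (E.obj h)) ⟶ T,
      (∀ {h k : H'.V} (e : h ⟶ k), φ.map (Δ'.map (E.map e)) ≫ x k = x h) →
      ∃! f : φ.obj p' ⟶ T, ∀ h, φ.map (l' (E.obj h)) ≫ f = x h := by
    rintro _ rfl x hx
    exact ht'.2 T x hx
  obtain ⟨f, hf, hf'⟩ := key (J ⋙q I) hJI (fun h => x (J.obj h)) fun e => hx (J.map e)
  refine ⟨f, fun h => ?_, fun g hg => hf' g fun h => hg (J.obj h)⟩
  have hh : J.obj (I.obj h) = h := congrArg (fun E : H.V ⥤q H.V => E.obj h) hIJ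
  exact Eq.subst (motive := fun z => φ.map (l' (I.obj z)) ≫ f = x z) hh (hf (I.obj h))

theorem CoconeDatum.Equivalent.isColimiting_map {W : Type*} [Quiver W] {C : Type*} [Category* C]
    {t t' : CoconeDatum W} (h : t.Equivalent t') (φ : W ⥤q C) (ht' : (t'.map φ).IsColimiting) :
    (t.map φ).IsColimiting := by
  obtain ⟨I, J, hIJ, hJI, e⟩ := h
  rw [e]
  exact t'.isColimiting_reindex_map _ I J hIJ hJI φ ht'

/-! ### Fibres over an `X`-structure, and sketches of finite kind. -/

namespace ExactnessSketch

section Fibers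

variable {X Z : ExactnessSketch} {C : Type u} [Category.{v} C]

theorem Str.eqToHom_app {S T : Z.Str C} (h : S = T) (a : Z.V) :
    (eqToHom h).app a = eqToHom (congrArg (fun S : Z.Str C => S.graph.obj a) h) := by
  subst h
  rfl

theorem Str.graph_map_of_eq {S T : Z.Str C} (h : S = T) {a b : Z.V} (f : a ⟶ b) :
    S.graph.map f = eqToHom (congrArg (fun S : Z.Str C => S.graph.obj a) h) ≫ T.graph.map f ≫
      eqToHom (congrArg (fun S : Z.Str C => S.graph.obj b) h.symm) := by
  subst h
  simp

variable {φ : Hom X Z} {F : X.Str C}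

theorem Extensions.obj_eq (G : Extensions φ F) (x : X.V) :
    G.1.graph.obj (φ.graph.obj x) = F.graph.obj x :=
  congrArg (fun S : X.Str C => S.graph.obj x) G.2

theorem Extensions.map_eq (G : Extensions φ F) {x x' : X.V} (f : x ⟶ x') :
    G.1.graph.map (φ.graph.map f) =
      eqToHom (G.obj_eq x) ≫ F.graph.map f ≫ eqToHom (G.obj_eq x').symm :=
  Str.graph_map_of_eq G.2 f

/-- Lying over the identity is tested vertexwise on `X`; together with `Extensions.hom_app` this
makes the fibres concrete. -/
theorem Extensions.isHomLift (G G' : Extensions φ F) (m : G.1 ⟶ G'.1)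
    (h : ∀ x, m.app (φ.graph.obj x) = eqToHom ((G.obj_eq x).trans (G'.obj_eq x).symm)) :
    (restrict φ C).IsHomLift (𝟙 F) m := by
  refine IsHomLift.of_fac' _ _ _ G.2 G'.2 ?_
  rw [Category.id_comp, eqToHom_trans]
  refine Str.Hom.ext (funext fun x => ?_)
  rw [Str.eqToHom_app]
  exact h x

theorem Extensions.hom_app (G G' : Extensions φ F) (m : G ⟶ G') (x : X.V) :
    m.1.app (φ.graph.obj x) = eqToHom ((G.obj_eq x).trans (G'.obj_eq x).symm) := by
  have := m.2
  have h1 := IsHomLift.fac' (restrict φ C) (𝟙 F) m.1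
  rw [Category.id_comp, eqToHom_trans] at h1
  have h2 := congrArg (fun n => Str.Hom.app n x) h1
  exact h2.trans (Str.eqToHom_app _ _)

theorem Extensions.eqToHom_app {G G' : Extensions φ F} (h : G = G') (a : Z.V) :
    (eqToHom h).1.app a =
      eqToHom (congrArg (fun S : Extensions φ F => S.1.graph.obj a) h) := by
  subst h
  rfl

theorem Extensions.hom_ext {G G' : Extensions φ F} {m m' : G ⟶ G'}
    (h : ∀ a, m.1.app a = m'.1.app a) : m = m' :=
  Subtype.ext (Str.Hom.ext (funext h))

theorem Extensions.comp_app {G G' G'' : Extensions φ F} (m : G ⟶ G') (m' : G' ⟶ G'') (a : Z.V) :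
    (m ≫ m').1.app a = m.1.app a ≫ m'.1.app a :=
  rfl

theorem locallySmall_extensions [LocallySmall.{w} C] : LocallySmall.{w} (Extensions φ F) where
  hom_small G G' :=
    small_of_injective (β := ∀ a, Shrink.{w} (G.1.graph.obj a ⟶ G'.1.graph.obj a))
      (f := fun m a => equivShrink _ (m.1.app a)) fun _ _ h =>
        Extensions.hom_ext fun a => (equivShrink _).injective (congrFun h a)

end Fibers

section FiniteKind

variable {X A : ExactnessSketch}

/-- A structure of category on the graph of `A` exhibiting `α` as unconditional of finite kind. -/
structure FiniteKindData (α : Hom X A) where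
  ident : ∀ a : A.V, a ⟶ a
  comp : ∀ {a b c : A.V}, (a ⟶ b) → (b ⟶ c) → (a ⟶ c)
  id_comp : ∀ {a b : A.V} (f : a ⟶ b), comp (ident a) f = f
  comp_id : ∀ {a b : A.V} (f : a ⟶ b), comp f (ident b) = f
  assoc : ∀ {a b c d : A.V} (f : a ⟶ b) (g : b ⟶ c) (h : c ⟶ d),
    comp (comp f g) h = comp f (comp g h)
  comm_iff : ∀ {a b : A.V} (p q : Quiver.Path a b),
    A.comm p q ↔ CategoryCondition ident comp p q ∨ ImageCondition α p q
  lim_iff : ∀ t : ConeDatum A.V, t ∈ A.lim ↔ ∃ s ∈ X.lim, t.Equivalent (s.map α.graph)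
  colim_iff : ∀ t : CoconeDatum A.V, t ∈ A.colim ↔ ∃ s ∈ X.colim, t.Equivalent (s.map α.graph)

theorem Hom.UnconditionalOfFiniteKind.nonempty_finiteKindData {α : Hom X A}
    (hα : α.UnconditionalOfFiniteKind) : Nonempty (FiniteKindData α) := by
  obtain ⟨-, ident, comp, h1, h2, h3, h4, h5, h6⟩ := hα
  exact ⟨⟨ident, comp, h1, h2, h3, h4, h5, h6⟩⟩

namespace FiniteKindData

variable {α : Hom X A} (d : FiniteKindData α)

/-- The category underlying `A`. -/
def Cat (_ : FiniteKindData α) : Type := A.V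

instance : SmallCategory d.Cat where
  Hom a b := @Quiver.Hom A.V _ a b
  id a := d.ident a
  comp f g := d.comp f g
  id_comp f := d.id_comp f
  comp_id f := d.comp_id f
  assoc f g h := d.assoc f g h

instance (a b : d.Cat) : Finite (a ⟶ b) := A.finiteHom a b

variable {C : Type u} [Category.{v} C]

/-- The functor underlying an `A`-structure. -/
def toFunctor (S : A.Str C) : d.Cat ⥤ C where
  obj a := S.graph.obj a
  map f := S.graph.map f
  map_id a := by
    have := S.comm _ _ ((d.comm_iff _ _).2 (Or.inl (.ofId a)))
    exact (Category.id_comp _).symm.trans this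
  map_comp {a b c} f g := by
    have := S.comm _ _ ((d.comm_iff _ _).2 (Or.inl (.ofComp f g)))
    refine (Category.id_comp _).symm.trans (this.symm.trans ?_)
    exact congrArg (· ≫ S.graph.map g) (Category.id_comp _)

/-- The transformation underlying a morphism of `A`-structures. -/
def toNatTrans {S T : A.Str C} (m : S ⟶ T) : d.toFunctor S ⟶ d.toFunctor T where
  app a := m.app a
  naturality _ _ f := m.naturality f

/-- The underlying graph morphism of a functor. -/
def toGraph (K : d.Cat ⥤ C) : A.V ⥤q C where
  obj a := K.obj a
  map f := K.map (X := _) (Y := _) f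

/-- A functor extending an `X`-structure is an `A`-structure. -/
theorem exists_structure (F : X.Str C) (K : d.Cat ⥤ C)
    (hK : α.graph ⋙q d.toGraph K = F.graph) : ∃ S : Extensions α F, S.1.graph = d.toGraph K := by
  obtain ⟨F, hF1, hF2, hF3⟩ := F
  dsimp only at hK
  subst hK
  refine ⟨⟨
    { graph := d.toGraph K
      comm := fun {a b} p q h => ?_
      lim := fun t ht => ?_
      colim := fun t ht => ?_ }, rfl⟩, rfl⟩
  · rcases (d.comm_iff p q).1 h with h | h
    · cases h with
      | ofComp f g =>
        change (𝟙 _ ≫ (d.toGraph K).map f) ≫ (d.toGraph K).map g =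
          𝟙 _ ≫ (d.toGraph K).map (d.comp f g)
        rw [Category.id_comp, Category.id_comp]
        exact (K.map_comp (X := _) (Y := _) (Z := _) f g).symm
      | ofId => exact (Category.id_comp _).trans (K.map_id _)
    · cases h with
      | of p q h' =>
        rw [← Prefunctor.mapPath_comp_apply, ← Prefunctor.mapPath_comp_apply]
        exact hF1 p q h'
  · obtain ⟨s, hs, e⟩ := (d.lim_iff t).1 ht
    exact e.isLimiting_map _ (hF2 s hs)
  · obtain ⟨s, hs, e⟩ := (d.colim_iff t).1 ht
    exact e.isColimiting_map _ (hF3 s hs)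

end FiniteKindData

end FiniteKind

end ExactnessSketch

theorem eq_of_eqToHom_comp_eq_comp {D : Type*} [Category* D] {a a' b b' c c' : D} (p : a = b)
    (p' : a' = b') (q : a = c) (q' : a' = c') (f : b ⟶ b') (g : c ⟶ c')
    (h : (eqToHom p ≫ f ≫ eqToHom p'.symm) ≫ eqToHom q' = eqToHom q ≫ g) :
    g = eqToHom (q.symm.trans p) ≫ f ≫ eqToHom (p'.symm.trans q') := by
  subst p p' q q'
  simpa using h.symm

theorem map_eqToHom_comp_eqToHom {C D : Type*} [Category* C] [Category* D] (T : C ⥤ D)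
    {a a' b b' : C} (p : a = b) (p' : b' = a') (f : b ⟶ b') :
    T.map (eqToHom p ≫ f ≫ eqToHom p') =
      eqToHom (congrArg T.obj p) ≫ T.map f ≫ eqToHom (congrArg T.obj p') := by
  subst p p'
  simp

theorem eq_eqToHom_of_comp_eq {D : Type*} [Category* D] {a b c : D} (p : a = b) (q : a = c)
    {g : b ⟶ c} (h : eqToHom p ≫ g = eqToHom q) : g = eqToHom (p.symm.trans q) := by
  subst p q
  simpa using h

/-! ### Uniformity for extensions in the pro-completion. -/

namespace IsProCompletion

open ExactnessSketch

variable {X A : ExactnessSketch} {α : X.Hom A} {C : Type u} [SmallCategory C]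
  {P : Type w} [Category.{w'} P] {y : C ⥤ P} (hy : IsProCompletion y) (F : X.Str C)

theorem full_onExtensions (α : X.Hom A) : (hy.onExtensions α F).Full where
  map_surjective {K L} m := by
    have := hy.full
    have := hy.faithful
    let m' : ∀ a, K.1.graph.obj a ⟶ L.1.graph.obj a := fun a =>
      y.preimage (X := K.1.graph.obj a) (Y := L.1.graph.obj a) (m.1.app a)
    have hm' : ∀ a, y.map (m' a) = m.1.app a := fun a => y.map_preimage _
    let n : K.1 ⟶ L.1 := ⟨m', fun {a b} f => y.map_injective (by
      rw [y.map_comp, y.map_comp, hm', hm']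
      exact m.1.naturality f)⟩
    refine ⟨⟨n, Extensions.isHomLift _ _ _ fun x => y.map_injective ?_⟩,
      Extensions.hom_ext hm'⟩
    rw [eqToHom_map]
    exact (hm' _).trans (Extensions.hom_app _ _ m x)

theorem faithful_onExtensions (α : X.Hom A) : (hy.onExtensions α F).Faithful where
  map_injective {K L} m m' h := Extensions.hom_ext fun a => by
    have := hy.faithful
    exact y.map_injective (congrArg (fun n => n.1.app a) h)

theorem injective_onExtensions (hinj : Function.Injective y.obj) (α : X.Hom A) :
    Function.Injective (hy.onExtensions α F).obj := by
  intro K L h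
  have h' : ((hy.onExtensions α F).obj K).1 = ((hy.onExtensions α F).obj L).1 :=
    congrArg Subtype.val h
  have := hy.faithful
  have hobj : ∀ a, K.1.graph.obj a = L.1.graph.obj a := fun a =>
    hinj (congrArg (fun S : A.Str P => S.graph.obj a) h')
  refine Subtype.ext (Str.ext (Prefunctor.ext_of_eqToHom hobj fun {a b} f => ?_))
  apply y.map_injective
  exact (Str.graph_map_of_eq h' f).trans (map_eqToHom_comp_eqToHom y _ _ _).symm

variable {F} (d : FiniteKindData α)

/-- The comparison between extensions of `F` below `G` and functors below `G`. -/
def toStructuredArrow (G : Extensions α ((hy.onStr X).obj F)) :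
    StructuredArrow G (hy.onExtensions α F) ⥤
      StructuredArrow (d.toFunctor G.1) ((Functor.whiskeringRight d.Cat C P).obj y) where
  obj j := StructuredArrow.mk (Y := d.toFunctor j.right.1) (d.toNatTrans j.hom.1)
  map {j k} f := StructuredArrow.homMk (d.toNatTrans f.right.1) (by
    ext a
    have h1 := StructuredArrow.w f
    exact congrArg (fun n => n.1.app a) h1)
  map_id _ := rfl
  map_comp _ _ := rfl

/-- The strict factorization through `K` has identity components at the vertices of `X`. Naturality
there and faithfulness of `y` force `K` to agree with `F` on arrows too, so `K` extends `F`.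
Unconditionality, carried by `d`, is what makes the functor `K` an `A`-structure with nothing more
to check. -/
theorem exists_toStructuredArrow_hom [HasFiniteLimits C] (hα : α.IsSubsketchInclusion)
    (G : Extensions α ((hy.onStr X).obj F))
    (N : StructuredArrow (d.toFunctor G.1) ((Functor.whiskeringRight d.Cat C P).obj y)) :
    ∃ j, Nonempty ((hy.toStructuredArrow d G).obj j ⟶ N) := by
  have := hy.full
  have := hy.faithful
  have := hy.preservesFiniteLimits
  obtain ⟨K, t, s, h, h1, h2⟩ := exists_factor y (A := d.Cat) (I := X.V) α.graph.obj hα.1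
    F.graph.obj (d.toFunctor G.1) (fun x => eqToIso (G.obj_eq x)) N.right N.hom
  have h2' : ∀ x, t.app (α.graph.obj x) =
      eqToHom ((G.obj_eq x).trans (congrArg y.obj (h x))) := fun x => by
    refine (h2 x).trans ?_
    change eqToHom (G.obj_eq x) ≫ eqToHom (congrArg y.obj (h x)) = _
    exact eqToHom_trans _ _
  have hK : α.graph ⋙q d.toGraph K = F.graph := by
    refine Prefunctor.ext_of_eqToHom (fun x => (h x).symm) fun {x x'} f => ?_
    apply y.map_injective
    have h3 : G.1.graph.map (α.graph.map f) ≫ t.app (α.graph.obj x') =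
      t.app (α.graph.obj x) ≫ y.map ((α.graph ⋙q d.toGraph K).map f) :=
      t.naturality (X := α.graph.obj x) (Y := α.graph.obj x') (α.graph.map f)
    rw [h2', h2', Extensions.map_eq G f] at h3
    exact (eq_of_eqToHom_comp_eq_comp _ (G.obj_eq x') _ ((G.obj_eq x').trans (congrArg y.obj (h x')))
      _ _ h3).trans (map_eqToHom_comp_eqToHom y _ _ _).symm
  obtain ⟨S, hS⟩ := d.exists_structure F K hK
  obtain ⟨S, hS'⟩ := S
  obtain ⟨Sg, S1, S2, S3⟩ := S
  dsimp only at hS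
  subst hS
  let K' : Extensions α F := ⟨⟨d.toGraph K, S1, S2, S3⟩, hS'⟩
  let t' : G.1 ⟶ ((hy.onExtensions α F).obj K').1 :=
    ⟨fun a => t.app a, fun {a b} f => t.naturality (X := a) (Y := b) f⟩
  have ht' : (restrict α P).IsHomLift (𝟙 ((hy.onStr X).obj F)) t' :=
    Extensions.isHomLift _ _ _ h2'
  refine ⟨StructuredArrow.mk (Y := K') ⟨t', ht'⟩, ⟨StructuredArrow.homMk s ?_⟩⟩
  exact h1

/-- The uniformity property: an extension `G` of `y F` is a cofiltered limit of extensions of `F`. -/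
theorem uniformity [HasFiniteLimits C] (hα : α.UnconditionalOfFiniteKind)
    (G : Extensions α ((hy.onStr X).obj F)) :
    IsCofiltered (StructuredArrow G (hy.onExtensions α F)) ∧ ∀ (a : A.V) (c : C),
      (∀ g : G.1.graph.obj a ⟶ y.obj c, ∃ (K : Extensions α F)
        (t : G ⟶ (hy.onExtensions α F).obj K) (h : K.1.graph.obj a ⟶ c),
        t.1.app a ≫ y.map h = g) ∧
      (∀ (j : StructuredArrow G (hy.onExtensions α F)) (h h' : j.right.1.graph.obj a ⟶ c),
        j.hom.1.app a ≫ y.map h = j.hom.1.app a ≫ y.map h' →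
          ∃ (k : StructuredArrow G (hy.onExtensions α F)) (f : k ⟶ j),
            f.right.1.app a ≫ h = f.right.1.app a ≫ h') := by
  obtain ⟨d⟩ := hα.nonempty_finiteKindData
  have := hy.full
  have := hy.faithful
  have := hy.preservesFiniteLimits
  have := hy.full_onExtensions F α
  -- A transformation under `G` between extensions is automatically the identity on `X`: both legs
  -- are identities there, and `y` is faithful.
  have hfull : (hy.toStructuredArrow d G).Full := ⟨fun {j k} p => by
    let m : ∀ a, j.right.1.graph.obj a ⟶ k.right.1.graph.obj a := fun a => p.right.app a
    let m' : j.right.1 ⟶ k.right.1 :=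
      ⟨m, fun {a b} f => p.right.naturality (X := a) (Y := b) f⟩
    have hm : ∀ a, j.hom.1.app a ≫ y.map (m a) = k.hom.1.app a := fun a =>
      NatTrans.congr_app (StructuredArrow.w p) a
    refine ⟨StructuredArrow.homMk ⟨m', Extensions.isHomLift _ _ _ fun x => ?_⟩ ?_, ?_⟩
    · apply y.map_injective
      have h1 := hm (α.graph.obj x)
      rw [Extensions.hom_app, Extensions.hom_app] at h1
      rw [eqToHom_map]
      exact eq_eqToHom_of_comp_eq _ _ h1
    · exact Extensions.hom_ext hm
    · rfl⟩
  have hfaithful : (hy.toStructuredArrow d G).Faithful := ⟨fun {j k f g} h => by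
    refine StructuredArrow.hom_ext _ _ (Extensions.hom_ext fun a => ?_)
    have h1 := congrArg (fun q => q.right) h
    exact NatTrans.congr_app h1 a⟩
  obtain ⟨h1, h2⟩ := exists_factor_of_coinduced (hy.toStructuredArrow d G)
    (hy.exists_toStructuredArrow_hom d hα.1 G)
  refine ⟨h1, fun a c => ⟨fun g => ?_, (h2 a c).2⟩⟩
  obtain ⟨j, h, hh⟩ := (h2 a c).1 g
  exact ⟨j.right, j.hom, h, hh⟩

end IsProCompletion

section EqToHom

variable {D : Type*} [Category* D]

theorem comp_eqToHom_comp_eqToHom_symm_comp {a b c d : D} (t : a ⟶ b) (p : b = c) (k : b ⟶ d) :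
    (t ≫ eqToHom p) ≫ eqToHom p.symm ≫ k = t ≫ k := by
  subst p
  simp

theorem eq_eqToHom_comp_of_eqToHom_comp_eq {a b c d : D} (p : a = b) (q : a = c) {f : b ⟶ d}
    {g : c ⟶ d} (h : eqToHom p ≫ f = eqToHom q ≫ g) : f = eqToHom (p.symm.trans q) ≫ g := by
  subst p q
  simpa using h

theorem eq_eqToHom_of_comp_eqToHom_eq {a b c : D} (p : b = c) (q : a = c) {f : a ⟶ b}
    (h : f ≫ eqToHom p = eqToHom q) : f = eqToHom (q.trans p.symm) := by
  subst p q
  simpa using h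

theorem eqToHom_conj_comm_sq {a a' b b' c c' d d' : D} (e : a' = a) (e' : b' = b) (p : c = c')
    (p' : d = d') {f : a ⟶ b} {t : a ⟶ c} {t' : b ⟶ d} {g : c ⟶ d} (h : f ≫ t' = t ≫ g) :
    (eqToHom e ≫ t ≫ eqToHom p) ≫ eqToHom p.symm ≫ g ≫ eqToHom p' =
      (eqToHom e ≫ f ≫ eqToHom e'.symm) ≫ eqToHom e' ≫ t' ≫ eqToHom p' := by
  subst e e' p p'
  simpa using h.symm

theorem eqToHom_conj_eqToHom {a b c d : D} (p : a = b) (q : c = d) (r : b = c) {f : b ⟶ c}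
    (h : f = eqToHom r) : eqToHom p ≫ f ≫ eqToHom q = eqToHom (p.trans (r.trans q)) := by
  rw [h, eqToHom_trans, eqToHom_trans]

end EqToHom

theorem ExactnessSketch.IsVertexwiseLimit.existsUnique_lift {Z : ExactnessSketch} {P : Type w}
    [Category.{w'} P] {J : Type*} [Category* J] {D : J ⥤ Z.Str P} {S : Z.Str P}
    {π : ∀ (b : Z.V) (j : J), S.graph.obj b ⟶ (D.obj j).graph.obj b}
    (hS : IsVertexwiseLimit D S.graph π) {T : Z.Str P} (x : ∀ j, T ⟶ D.obj j)
    (hx : ∀ {j k : J} (q : j ⟶ k), x j ≫ D.map q = x k) :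
    ∃! l : T ⟶ S, ∀ j b, l.app b ≫ π b j = (x j).app b := by
  choose l hl using fun b => hS.exists_lift b (fun j => (x j).app b)
    fun q => congrArg (fun m => m.app b) (hx q)
  refine ⟨⟨l, fun {a b} f => hS.hom_ext _ _ _ fun j => ?_⟩, fun j b => hl b j, fun m hm =>
    Str.Hom.ext (funext fun b => hS.hom_ext _ _ _ fun j => (hm j b).trans (hl b j).symm)⟩
  rw [Category.assoc, hl, Category.assoc, hS.naturality, ← Category.assoc, hl, (x j).naturality]

/-! ### The limit structure above an extension `G`. -/

namespace IsProCompletion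

open ExactnessSketch

variable {X A B : ExactnessSketch} {α : X.Hom A} {β : A.Hom B} {C : Type u} [SmallCategory C]
  {P : Type w} [Category.{w'} P] {y : C ⥤ P} (hy : IsProCompletion y) {F : X.Str C}

/-- By uniformity every arrow from `G a` to some `y c` passes through an arrow from `G` to an
extension coming from `C`, and by codensity such arrows detect equality. -/
theorem extensions_hom_ext [HasFiniteLimits C] (hα : α.UnconditionalOfFiniteKind)
    {G G' : Extensions α ((hy.onStr X).obj F)} (m m' : G' ⟶ G)
    (h : ∀ (K : Extensions α F) (t : G ⟶ (hy.onExtensions α F).obj K), m ≫ t = m' ≫ t) :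
    m = m' := by
  refine Extensions.hom_ext fun a => hy.isCodense.hom_ext fun c g => ?_
  obtain ⟨K, t, h', rfl⟩ := ((hy.uniformity hα G).2 a c).1 g
  have h1 : m.1.app a ≫ t.1.app a = m'.1.app a ≫ t.1.app a :=
    congrArg (fun n => n.1.app a) (h K t)
  exact (Category.assoc _ _ _).symm.trans ((congrArg (· ≫ y.map h') h1).trans (Category.assoc _ _ _))

/-- The category `P` may live in other universes; this smallness is what allows the colimits in
`Type u` behind `exists_isAccessibleCone`. -/
theorem essentiallySmall_structuredArrow (G : Extensions α ((hy.onStr X).obj F)) :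
    EssentiallySmall.{u} (StructuredArrow G (hy.onExtensions α F)) := by
  have := hy.locallySmall
  have : LocallySmall.{u} (Extensions α ((hy.onStr X).obj F)) := locallySmall_extensions
  have : EssentiallySmall.{u} (Extensions α F) := essentiallySmallSelf (C := Extensions α F)
  infer_instance

variable (βF : FunctorialVerification α β F)

/-- The values of a functorial verification, transported along `y`. -/
abbrev verificationValues : Extensions α F ⥤ Extensions (α.comp β) ((hy.onStr X).obj F) :=
  βF.functor ⋙ hy.onExtensions (α.comp β) F

theorem verificationValues_comp_restrict :
    hy.verificationValues βF ⋙ restrictExtensions α β ((hy.onStr X).obj F) =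
      hy.onExtensions α F := by
  have h1 : hy.onExtensions (α.comp β) F ⋙ restrictExtensions α β ((hy.onStr X).obj F) =
    restrictExtensions α β F ⋙ hy.onExtensions α F := rfl
  rw [verificationValues, Functor.assoc, h1, ← Functor.assoc, βF.comp_restrict, Functor.id_comp]

theorem restrict_verificationValues (K : Extensions α F) :
    (restrict β P).obj ((hy.verificationValues βF).obj K).1 = ((hy.onExtensions α F).obj K).1 :=
  congrArg Subtype.val (Functor.congr_obj (hy.verificationValues_comp_restrict βF) K)

theorem verificationValues_obj (K : Extensions α F) (a : A.V) :
    ((hy.onExtensions α F).obj K).1.graph.obj a =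
      ((hy.verificationValues βF).obj K).1.graph.obj (β.graph.obj a) :=
  congrArg (fun S : A.Str P => S.graph.obj a) (hy.restrict_verificationValues βF K).symm

theorem verificationValues_map {K L : Extensions α F} (m : K ⟶ L) (a : A.V) :
    ((hy.verificationValues βF).map m).1.app (β.graph.obj a) =
      eqToHom (hy.verificationValues_obj βF K a).symm ≫ y.map (m.1.app a) ≫
        eqToHom (hy.verificationValues_obj βF L a) := by
  have h1 := Functor.congr_hom (hy.verificationValues_comp_restrict βF) m
  have h2 := congrArg (fun n => n.1.app a) h1
  refine h2.trans ?_
  rw [Extensions.comp_app, Extensions.comp_app, Extensions.eqToHom_app, Extensions.eqToHom_app]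
  rfl

/-- The diagram of structures whose limit is the value at `G` of the extended verification. -/
abbrev verificationDiagram (G : Extensions α ((hy.onStr X).obj F)) :
    StructuredArrow G (hy.onExtensions α F) ⥤ B.Str P :=
  StructuredArrow.proj G (hy.onExtensions α F) ⋙ hy.verificationValues βF ⋙
    Functor.Fiber.fiberInclusion

/-- At a vertex `a` of `A` the strict section property turns the diagram into `K ↦ y (K a)`, and the
cone with apex `G a` is accessible by uniformity. At other vertices the diagram is the image under
`y` of a diagram in `C`, so some accessible cone exists. Injectivity of `β` on vertices leaves only
one apex to prescribe. -/
theorem exists_isAccessibleCone_verificationDiagram [HasFiniteLimits C]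
    (hα : α.UnconditionalOfFiniteKind) (hβ : β.IsSubsketchInclusion)
    (G : Extensions α ((hy.onStr X).obj F)) (b : B.V) :
    ∃ c : Cone (hy.verificationDiagram βF G ⋙ Str.eval B P b), IsAccessibleCone y c ∧
      ∀ (a : A.V) (h : β.graph.obj a = b), ∃ e : c.pt = G.1.graph.obj a, ∀ j,
        c.π.app j = eqToHom e ≫ j.hom.1.app a ≫
          eqToHom ((hy.verificationValues_obj βF j.right a).trans (congrArg
            ((hy.verificationValues βF).obj j.right).1.graph.obj h)) := by
  obtain ⟨h1, h2⟩ := hy.uniformity hα G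
  have := hy.essentiallySmall_structuredArrow G
  by_cases hb : ∃ a, β.graph.obj a = b
  · obtain ⟨a, rfl⟩ := hb
    let c : Cone (hy.verificationDiagram βF G ⋙ Str.eval B P (β.graph.obj a)) :=
      { pt := G.1.graph.obj a
        π :=
          { app j := j.hom.1.app a ≫ eqToHom (hy.verificationValues_obj βF j.right a)
            naturality j k f := by
              have h3 : j.hom.1.app a ≫ y.map (f.right.1.app a) = k.hom.1.app a :=
                congrArg (fun n => n.1.app a) (StructuredArrow.w f)
              have h4 := hy.verificationValues_map βF f.right a
              refine (Category.id_comp _).trans ?_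
              refine Eq.trans ?_ ((congrArg ((j.hom.1.app a ≫
                eqToHom (hy.verificationValues_obj βF j.right a)) ≫ ·) h4).symm)
              rw [Category.assoc, eqToHom_trans_assoc, eqToHom_refl, Category.id_comp]
              exact ((congrArg (· ≫ eqToHom (hy.verificationValues_obj βF k.right a)) h3).symm.trans
                (Category.assoc _ _ _)) } }
    refine ⟨c, ⟨fun {x} g => ?_, fun {x j} g g' hg => ?_⟩, fun a' h => ?_⟩
    · obtain ⟨K, t, h, hh⟩ := (h2 a x).1 g
      refine ⟨StructuredArrow.mk t, eqToHom (hy.verificationValues_obj βF K a).symm ≫ y.map h, ?_⟩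
      change (t.1.app a ≫ eqToHom (hy.verificationValues_obj βF K a)) ≫ eqToHom _ ≫ y.map h = g
      exact (comp_eqToHom_comp_eqToHom_symm_comp _ _ _).trans hh
    · have := hy.full
      have e := hy.verificationValues_obj βF j.right a
      obtain ⟨f, hf⟩ := y.map_surjective (X := j.right.1.graph.obj a) (eqToHom e ≫ g)
      obtain ⟨f', hf'⟩ := y.map_surjective (X := j.right.1.graph.obj a) (eqToHom e ≫ g')
      obtain ⟨k, p, hp⟩ := (h2 a x).2 j f f' (by
        rw [hf, hf']
        exact (Category.assoc _ _ _).symm.trans (hg.trans (Category.assoc _ _ _)))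
      refine ⟨k, p, ?_⟩
      have h4 := hy.verificationValues_map βF p.right a
      have h5 : ∀ (z : _ ⟶ y.obj x), ((hy.verificationValues βF).map p.right).1.app
          (β.graph.obj a) ≫ z = eqToHom (hy.verificationValues_obj βF k.right a).symm ≫
            y.map (p.right.1.app a) ≫ eqToHom e ≫ z := fun z =>
        (congrArg (· ≫ z) h4).trans ((Category.assoc _ _ _).trans
          (congrArg (eqToHom _ ≫ ·) (Category.assoc _ _ _)))
      refine (h5 g).trans (Eq.trans ?_ (h5 g').symm)
      rw [← hf, ← hf']
      exact congrArg (eqToHom _ ≫ ·) ((y.map_comp _ _).symm.trans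
        ((congrArg y.map hp).trans (y.map_comp _ _)))
    · obtain rfl := hβ.1 h
      exact ⟨rfl, fun j => (Category.id_comp _).symm⟩
  · obtain ⟨c, hc⟩ := hy.exists_isAccessibleCone (StructuredArrow.proj G (hy.onExtensions α F) ⋙
      βF.functor ⋙ Functor.Fiber.fiberInclusion ⋙ Str.eval B C b)
    exact ⟨c, hc, fun a h => (hb ⟨a, h⟩).elim⟩

theorem nonempty_strictLimitCone [HasFiniteLimits C] (hα : α.UnconditionalOfFiniteKind)
    (hβ : β.IsSubsketchInclusion)
    (h : ∀ K, (hy.onExtensions α F).obj K = (restrictExtensions α β ((hy.onStr X).obj F)).obj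
      ((hy.verificationValues βF).obj K)) (G : Extensions α ((hy.onStr X).obj F)) :
    Nonempty (StrictLimitCone (hy.onExtensions α F) (hy.verificationValues βF)
      (restrictExtensions α β ((hy.onStr X).obj F))
      (Functor.Fiber.fiberInclusion (p := restrict (α.comp β) P)) h G) := by
  obtain ⟨h1, -⟩ := hy.uniformity hα G
  choose c hc hcβ using hy.exists_isAccessibleCone_verificationDiagram βF hα hβ G
  obtain ⟨S, hS, π, S', hlim, rfl, hπ⟩ := exists_limit_structure hy.isCodense hc
  have e : ∀ a, S'.graph.obj (β.graph.obj a) = G.1.graph.obj a := fun a =>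
    (hS _).symm.trans (hcβ _ a rfl).choose
  have hπβ : ∀ (a : A.V) (j), π (β.graph.obj a) j = eqToHom (e a) ≫ j.hom.1.app a ≫
      eqToHom (hy.verificationValues_obj βF j.right a) := by
    intro a j
    have h2 := (hcβ _ a rfl).choose_spec j
    exact eq_eqToHom_comp_of_eqToHom_comp_eq _ _ ((hπ (β.graph.obj a) j).symm.trans h2)
  -- Vertices agree by the choice of apices; arrows agree because they have the same composites with
  -- all limit projections.
  have hr : (restrict β P).obj S' = G.1 := by
    refine Str.ext (Prefunctor.ext_of_eqToHom e fun {a b} f => ?_)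
    refine hlim.hom_ext _ _ _ fun j => ?_
    refine (hlim.naturality (β.graph.map f) j).trans ?_
    rw [hπβ, hπβ]
    refine (congrArg (_ ≫ ·) (Str.graph_map_of_eq
      (hy.restrict_verificationValues βF j.right) f)).trans ?_
    exact eqToHom_conj_comm_sq _ _ _ _ (j.hom.1.naturality f)
  let T : Extensions (α.comp β) ((hy.onStr X).obj F) :=
    ⟨S', (congrArg (restrict α P).obj hr).trans G.2⟩
  have hπα : ∀ (x : X.V) (j), π (β.graph.obj (α.graph.obj x)) j = eqToHom ((T.obj_eq x).trans
      (((hy.verificationValues βF).obj j.right).obj_eq x).symm) := fun x j =>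
    (hπβ _ j).trans (eqToHom_conj_eqToHom _ _ _ (Extensions.hom_app _ _ j.hom x))
  let ρ : ∀ j : StructuredArrow G (hy.onExtensions α F),
      T ⟶ (hy.verificationValues βF).obj j.right := fun j =>
    ⟨⟨fun b => π b j, fun f => hlim.naturality f j⟩, Extensions.isHomLift _ _ _ fun x => hπα x j⟩
  let cc : CommaCone (hy.onExtensions α F) (hy.verificationValues βF) G :=
    { pt := T
      π := fun {K} t => ρ (StructuredArrow.mk t)
      w := fun {K L} t f => Extensions.hom_ext fun b =>
        hlim.w b (StructuredArrow.homMk f : StructuredArrow.mk t ⟶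
          StructuredArrow.mk (t ≫ (hy.onExtensions α F).map f)) }
  have hT : (restrictExtensions α β ((hy.onStr X).obj F)).obj T = G := Subtype.ext hr
  refine ⟨{ cc with
    isLimit := IsLimit.ofExistsUnique fun s => ?_
    isLimitMap := IsLimit.ofExistsUnique fun s => ?_
    obj_eq := hT
    map_eq := fun {K} t => Extensions.hom_ext fun a => ?_ }⟩
  · obtain ⟨l, hl, hl'⟩ := hlim.existsUnique_lift (T := s.pt.1) (fun j => (s.π.app j).1)
      fun q => congrArg Subtype.val (s.w q)
    -- One leg suffices to see that the lift is the identity on `X`, since legs are identities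
    -- there; hence the need for a nonempty comma category.
    have j := h1.nonempty.some
    refine ⟨⟨l, Extensions.isHomLift s.pt T l fun x => ?_⟩, fun j => Extensions.hom_ext (hl j),
      fun m hm => Subtype.ext (hl' m.1 fun j b => congrArg (fun n => n.1.app b) (hm j))⟩
    have h2 := hl j (β.graph.obj (α.graph.obj x))
    rw [hπα] at h2
    exact eq_eqToHom_of_comp_eqToHom_eq _ _ (h2.trans (Extensions.hom_app _ _ (s.π.app j) x))
  -- Here the competing cone is an arbitrary cone of `B`-structures, with no condition on its
  -- restriction to `X`; this yields the limit in all of `B P` and not only in the fibre.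
  · obtain ⟨l, hl, hl'⟩ := hlim.existsUnique_lift (T := s.pt) (fun j => s.π.app j) fun q => s.w q
    exact ⟨l, fun j => Str.Hom.ext (funext (hl j)),
      fun m hm => hl' m fun j b => congrArg (fun n => Str.Hom.app n b) (hm j)⟩
  · refine (hπβ a (StructuredArrow.mk t)).trans ?_
    exact (congrArg₂ (fun p q => p ≫ t.1.app a ≫ q) (Extensions.eqToHom_app hT a)
      (Extensions.eqToHom_app (h K) a)).symm

end IsProCompletion

/-- Coherence of the stability theorem. The right inverse `βyF` of `β^α_{yF}` extends the given right
inverse `βF` of `β^α_F` strictly, and its value at `G` is the limit in `B P` (with limiting cone given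
by the morphisms `βyF t`) of the structures `βyF (y K) = y (βF K)`, taken over all pairs `(K, t)` with
`K` in `A^α_F C` and `t : G ⟶ y K` in `A^α_{yF} P`. -/
theorem mainTheorem4 {X A B : ExactnessSketch} (α : X.Hom A) (β : A.Hom B)
    (hα : α.UnconditionalOfFiniteKind) (hβ : β.IsSubsketchInclusion)
    {C : Type u} [SmallCategory C] [HasFiniteLimits C]
    {P : Type w} [Category.{w'} P] (y : C ⥤ P) (hy : IsProCompletion y)
    (hinj : Function.Injective y.obj) (F : X.Str C)
    (βF : ExactnessSketch.FunctorialVerification α β F) :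
    ∃ βyF : ExactnessSketch.FunctorialVerification α β ((hy.onStr X).obj F),
      hy.onExtensions α F ⋙ βyF.functor = βF.functor ⋙ hy.onExtensions (α.comp β) F ∧
      Nonempty (Functor.RightExtension.mk (βyF.functor ⋙ Functor.Fiber.fiberInclusion)
        (𝟙 (hy.onExtensions α F ⋙ βyF.functor ⋙
          Functor.Fiber.fiberInclusion))).IsPointwiseRightKanExtension := by
  have := hy.full_onExtensions F α
  have := hy.faithful_onExtensions F α
  have hV := hy.verificationValues_comp_restrict βF
  have h := fun K => (Functor.congr_obj hV K).symm
  obtain ⟨T, h1, h2, h3⟩ := exists_strict_section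
    (I := Functor.Fiber.fiberInclusion (p := ExactnessSketch.restrict (α.comp β) P))
    (hy.injective_onExtensions F hinj α) hV h (hy.extensions_hom_ext hα)
    (hy.nonempty_strictLimitCone βF hα hβ h)
  exact ⟨⟨T, h1⟩, h2, h3⟩
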